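/- **Setup.** Let $n\ge 1$, $\beta>0$, and let $\mathcal H$ be a complex Hilbert space of dimension $2^n$ with Majorana operators $\gamma_1,\dots,\gamma_{2n}$: self-adjoint operators with $\gamma_j\gamma_k+\gamma_k\gamma_j=2\delta_{jk}$. For $\alpha\in\{0,1\}^{2n}$ put $\gamma^\alpha=\gamma_1^{\alpha_1}\cdots\gamma_{2n}^{\alpha_{2n}}$ and $|\alpha|=\sum_j\alpha_j$. Let $B(\mathcal H)_{\rm even}$ (resp. $B(\mathcal H)_{\rm odd}$) be the span of the $\gamma^\alpha$ with $|\alpha|$ even (resp. odd). Let $H\in B(\mathcal H)_{\rm even}$ be self-adjoint, $\sigma=e^{-\beta H}/\mathrm{Tr}\,e^{-\beta H}$, and $\gamma_j(t)=e^{iHt}\gamma_je^{-iHt}$. Define $$\mathcal L(\rho)=-i[B,\rho]+\sum_{j=1}^{2n}\int_{-\infty}^\infty \eta(\omega)\Big(A_j(\omega)\rho A_j(\omega)^\dagger-\tfrac12\{A_j(\omega)^\dagger A_j(\omega),\rho\}\Big)d\omega,$$ $$A_j(\omega)=\frac1{\sqrt{2\pi}}\int_{-\infty}^\infty\gamma_j(t)e^{-i\omega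 t}f(t)\,dt,\qquad B=\sum_{j=1}^{2n}\int_{-\infty}^\infty dt\,b_1(t)\int_{-\infty}^\infty dt'\,b_2(t')\,\gamma_j(\beta(t'-t))^\dagger\gamma_j(-\beta(t+t')),$$ where $f(t)=e^{-t^2/\beta^2}/\sqrt{\beta\sqrt{\pi/2}}$, $\eta(\omega)=e^{-(\beta\omega+1)^2/2}$, $b_2(t)=\frac{1}{2\pi^{3/2}}e^{-4t^2-2it}$, and $b_1=4\sqrt\pi\,e^{1/8}\,(g*h)$ is a multiple of the convolution of $g(t)=1/\cosh(2\pi t)$ and $h(t)=\sin(-t)e^{-2t^2}$. Let $\mathcal L^\dagger$ be the adjoint of $\mathcal L$ for the inner product $\mathrm{Tr}[X^\dagger Y]$. Let $\mathcal H'$ be the $2^{2n}$-dimensional Hilbert space with orthonormal basis $(v_\alpha)_{\alpha\in\{0,1\}^{2n}}$, $\varphi:B(\mathcal H)\to\mathcal H'$ the linear isomorphism with $\varphi(\gamma^\alpha)=v_\alpha$, and $(-1)^{\hat n}v_\alpha=(-1)^{|\alpha|}v_\alpha$. With $L_W(X)=WX$ and $R_W(X)=XW$, let $\Phi:B(B(\mathcal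 H))\to B(\mathcal H')$ be the linear map with $\Phi(L_WR_{W'})=\varphi L_WR_{W'}\varphi^{-1}$ for $W\in B(\mathcal H)$, $W'\in B(\mathcal H)_{\rm even}$, and $\Phi(L_WR_{W'})=\varphi L_WR_{W'}\varphi^{-1}(-1)^{\hat n}$ for $W\in B(\mathcal H)$, $W'\in B(\mathcal H)_{\rm odd}$. With $\Gamma(X)=\sigma^{1/4}X\sigma^{1/4}$, the parent Hamiltonian is $H^{\rm parent}=\Phi(\Gamma\circ\mathcal L^\dagger\circ\Gamma^{-1})$. **Lemma.** (i) $H^{\rm parent}$ is self-adjoint on all of $\mathcal H'$ (including the odd-parity sector). (ii) $\mathcal L^\dagger$ maps $B(\mathcal H)_{\rm even}$ into itself, and $0$ is an eigenvalue of both $H^{\rm parent}$ and $\mathcal L^\dagger|_{B(\mathcal H)_{\rm even}}$. Both operators have negative eigenvalues; if $-\Delta$ and $-\Delta'$ are the largest negative eigenvalues of $H^{\rm parent}$ and of $\mathcal L^\dagger|_{B(\mathcal H)_{\rm even}}$ respectively, then $\Delta\le\Delta'$. Moreover, the multiplicity of the eigenvalue $0$ of $\mathcal L^\dagger|_{B(\mathcal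 H)_{\rm even}}$ is at most that of $H^{\rm parent}$ (so the inequality between the gaps also holds when a repeated eigenvalue $0$ is counted as gap $0$). -/

import Mathlib

open MeasureTheory

set_option linter.unusedSectionVars false

noncomputable section

namespace ThirdQuantization

/-! ### Majorana operators and their ordered monomials -/

section Majorana

variable {E : Type*} [NormedAddCommGroup E] [InnerProductSpace ℂ E] [CompleteSpace E]

/-- `γ 0, …, γ (2n-1)` are the `2n` Majorana operators of a system of `n` Dirac modes with Hilbert
space `E` of dimension `2 ^ n`. -/
structure IsMajorana (n : ℕ) (γ : Fin (2 * n) → E →L[ℂ] E) : Prop where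
  finrank_eq : Module.finrank ℂ E = 2 ^ n
  isSelfAdjoint : ∀ j, IsSelfAdjoint (γ j)
  anticomm : ∀ j k, γ j * γ k + γ k * γ j = if j = k then 2 else 0

/-- The monomial `γ₁^{α₁} γ₂^{α₂} ⋯ γ_m^{α_m}`, factors in increasing order. -/
def monomial {m : ℕ} (γ : Fin m → E →L[ℂ] E) (α : Fin m → Fin 2) : E →L[ℂ] E :=
  (List.ofFn fun j => γ j ^ (α j : ℕ)).prod

/-- `|α| = α₁ + ⋯ + α_m`. -/
def weight {m : ℕ} (α : Fin m → Fin 2) : ℕ := ∑ j, (α j : ℕ)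

/-- `B(E)_even`. -/
def evenOps {m : ℕ} (γ : Fin m → E →L[ℂ] E) : Submodule ℂ (E →L[ℂ] E) :=
  Submodule.span ℂ {X | ∃ α, Even (weight α) ∧ X = monomial γ α}

/-- `B(E)_odd`. -/
def oddOps {m : ℕ} (γ : Fin m → E →L[ℂ] E) : Submodule ℂ (E →L[ℂ] E) :=
  Submodule.span ℂ {X | ∃ α, Odd (weight α) ∧ X = monomial γ α}

/-- The fermion parity operator `iⁿ γ₁ γ₂ ⋯ γ_{2n}`. -/
def parityOp {n : ℕ} (γ : Fin (2 * n) → E →L[ℂ] E) : E →L[ℂ] E :=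
  Complex.I ^ n • (List.ofFn γ).prod

theorem IsMajorana.mul_self {n : ℕ} {γ : Fin (2 * n) → E →L[ℂ] E} (h : IsMajorana n γ)
    (j : Fin (2 * n)) : γ j * γ j = 1 := by
  have h1 := h.anticomm j j
  rw [if_pos rfl, ← two_smul ℂ (γ j * γ j)] at h1
  have h2 : (2 : ℂ) • (γ j * γ j) = (2 : ℂ) • (1 : E →L[ℂ] E) := by
    rw [h1, two_smul, one_add_one_eq_two]
  exact smul_right_injective _ (two_ne_zero) h2

theorem IsMajorana.mem_unitary {n : ℕ} {γ : Fin (2 * n) → E →L[ℂ] E} (h : IsMajorana n γ)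
    (j : Fin (2 * n)) : γ j ∈ unitary (E →L[ℂ] E) := by
  rw [Unitary.mem_iff, (h.isSelfAdjoint j).star_eq]
  exact ⟨h.mul_self j, h.mul_self j⟩

theorem IsMajorana.monomial_mem_unitary {n : ℕ} {γ : Fin (2 * n) → E →L[ℂ] E}
    (h : IsMajorana n γ) (α : Fin (2 * n) → Fin 2) : monomial γ α ∈ unitary (E →L[ℂ] E) := by
  apply Submonoid.list_prod_mem
  intro x hx
  obtain ⟨j, rfl⟩ := (List.mem_ofFn' _ _).1 hx
  exact pow_mem (h.mem_unitary j) _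

theorem IsMajorana.parityOp_mem_unitary {n : ℕ} {γ : Fin (2 * n) → E →L[ℂ] E}
    (h : IsMajorana n γ) : parityOp γ ∈ unitary (E →L[ℂ] E) := by
  have hp : (List.ofFn γ).prod ∈ unitary (E →L[ℂ] E) := by
    apply Submonoid.list_prod_mem
    intro x hx
    obtain ⟨j, rfl⟩ := (List.mem_ofFn' _ _).1 hx
    exact h.mem_unitary j
  have hI : star (Complex.I ^ n) * Complex.I ^ n = 1 := by
    rw [star_pow, ← mul_pow]; simp
  rw [Unitary.mem_iff] at hp ⊢
  unfold parityOp
  simp only [star_smul, smul_mul_smul_comm, hp.1, hp.2, hI, mul_comm (Complex.I ^ n), one_smul,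
    and_self]

theorem IsMajorana.mul_listProd {n : ℕ} {γ : Fin (2 * n) → E →L[ℂ] E} (h : IsMajorana n γ)
    (j : Fin (2 * n)) (α : Fin (2 * n) → Fin 2) (l : List (Fin (2 * n))) :
    γ j * (l.map fun k => γ k ^ (α k : ℕ)).prod =
      (-1 : ℂ) ^ (l.map fun k => if k = j then 0 else (α k : ℕ)).sum •
        ((l.map fun k => γ k ^ (α k : ℕ)).prod * γ j) := by
  induction l with
  | nil => simp
  | cons k l ih =>
    have key : γ j * γ k ^ (α k : ℕ) =
        (-1 : ℂ) ^ (if k = j then 0 else (α k : ℕ)) • (γ k ^ (α k : ℕ) * γ j) := by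
      by_cases hk : k = j
      · subst hk
        simp [(Commute.refl (γ k)).pow_right (α k : ℕ) |>.eq]
      · have h1 := h.anticomm j k
        rw [if_neg (fun e => hk e.symm)] at h1
        rw [if_neg hk]
        have : (α k : ℕ) = 0 ∨ (α k : ℕ) = 1 := by omega
        rcases this with h0 | h0 <;> rw [h0]
        · simp
        · simpa using eq_neg_of_add_eq_zero_left h1
    rw [List.map_cons, List.prod_cons, ← mul_assoc, key, smul_mul_assoc, mul_assoc, ih,
      List.map_cons, List.sum_cons, pow_add, mul_smul_comm, smul_smul, mul_assoc]

theorem IsMajorana.mul_monomial {n : ℕ} {γ : Fin (2 * n) → E →L[ℂ] E} (h : IsMajorana n γ)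
    (j : Fin (2 * n)) (α : Fin (2 * n) → Fin 2) :
    γ j * monomial γ α = (-1 : ℂ) ^ (weight α + (α j : ℕ)) • (monomial γ α * γ j) := by
  have h1 := h.mul_listProd j α (List.finRange (2 * n))
  rw [← List.ofFn_eq_map, ← List.ofFn_eq_map, List.sum_ofFn] at h1
  have h2 : weight α = (∑ k, if k = j then 0 else (α k : ℕ)) + (α j : ℕ) := by
    have : (α j : ℕ) = ∑ k, if k = j then (α k : ℕ) else 0 := by simp
    rw [this, ← Finset.sum_add_distrib]
    exact Finset.sum_congr rfl fun k _ => by split_ifs <;> simp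
  unfold monomial
  rw [h1, h2, add_assoc, pow_add _ _ ((α j : ℕ) + α j), ← two_mul, pow_mul _ 2]
  simp

theorem IsMajorana.monomial_mul_parityOp {n : ℕ} {γ : Fin (2 * n) → E →L[ℂ] E}
    (h : IsMajorana n γ) (α : Fin (2 * n) → Fin 2) :
    parityOp γ * monomial γ α = (-1 : ℂ) ^ weight α • (monomial γ α * parityOp γ) := by
  have hP : ∀ j, parityOp γ * γ j = -(γ j * parityOp γ) := by
    intro j
    have h1 := h.mul_monomial j (fun _ => 1)
    have h2 : monomial γ (fun _ => 1) = (List.ofFn γ).prod := by simp [monomial]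
    have h3 : (-1 : ℂ) ^ (weight (fun _ : Fin (2 * n) => (1 : Fin 2)) + ((1 : Fin 2) : ℕ)) = -1 := by
      rw [pow_add]; simp [weight]
    rw [h2, h3] at h1
    simp only [parityOp, smul_mul_assoc, mul_smul_comm, h1]
    simp
  have key : ∀ l : List (Fin (2 * n)), parityOp γ * (l.map fun k => γ k ^ (α k : ℕ)).prod =
      (-1 : ℂ) ^ (l.map fun k => (α k : ℕ)).sum •
        ((l.map fun k => γ k ^ (α k : ℕ)).prod * parityOp γ) := by
    intro l
    induction l with
    | nil => simp
    | cons k l ih =>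
      have hk : parityOp γ * γ k ^ (α k : ℕ) = (-1 : ℂ) ^ (α k : ℕ) •
          (γ k ^ (α k : ℕ) * parityOp γ) := by
        have : (α k : ℕ) = 0 ∨ (α k : ℕ) = 1 := by omega
        rcases this with h0 | h0 <;> rw [h0]
        · simp
        · simpa using hP k
      rw [List.map_cons, List.prod_cons, ← mul_assoc, hk, smul_mul_assoc, mul_assoc, ih,
        List.map_cons, List.sum_cons, pow_add, mul_smul_comm, smul_smul, mul_assoc]
  have h1 := key (List.finRange (2 * n))
  rw [← List.ofFn_eq_map, ← List.ofFn_eq_map, List.sum_ofFn] at h1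
  exact h1

theorem IsMajorana.parityOp_conj_of_even {n : ℕ} {γ : Fin (2 * n) → E →L[ℂ] E}
    (h : IsMajorana n γ) {W : E →L[ℂ] E} (hW : W ∈ evenOps γ) :
    parityOp γ * W * star (parityOp γ) = W := by
  have hu := (Unitary.mem_iff.1 h.parityOp_mem_unitary).2
  induction hW using Submodule.span_induction with
  | mem x hx =>
    obtain ⟨α, hα, rfl⟩ := hx
    rw [h.monomial_mul_parityOp, hα.neg_one_pow, one_smul, mul_assoc, hu, mul_one]
  | zero => simp
  | add x y _ _ hx hy => rw [mul_add, add_mul, hx, hy]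
  | smul c x _ hx => rw [mul_smul_comm, smul_mul_assoc, hx]

theorem IsMajorana.parityOp_conj_of_odd {n : ℕ} {γ : Fin (2 * n) → E →L[ℂ] E}
    (h : IsMajorana n γ) {W : E →L[ℂ] E} (hW : W ∈ oddOps γ) :
    parityOp γ * W * star (parityOp γ) = -W := by
  have hu := (Unitary.mem_iff.1 h.parityOp_mem_unitary).2
  induction hW using Submodule.span_induction with
  | mem x hx =>
    obtain ⟨α, hα, rfl⟩ := hx
    rw [h.monomial_mul_parityOp, hα.neg_one_pow, smul_mul_assoc, mul_assoc, hu, mul_one,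
      neg_one_smul]
  | zero => simp
  | add x y _ _ hx hy => rw [mul_add, add_mul, hx, hy, neg_add]
  | smul c x _ hx => rw [mul_smul_comm, smul_mul_assoc, hx, smul_neg]

end Majorana

/-! ### Super-operators -/

section SuperOp

variable {E : Type*} [NormedAddCommGroup E] [InnerProductSpace ℂ E]

/-- The trace on `B(E)`. -/
def tr (X : E →L[ℂ] E) : ℂ := LinearMap.trace ℂ E (X : E →ₗ[ℂ] E)

/-- `L_W(X) = W X`. -/
def leftMul (W : E →L[ℂ] E) : (E →L[ℂ] E) →L[ℂ] (E →L[ℂ] E) :=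
  ContinuousLinearMap.mul ℂ (E →L[ℂ] E) W

/-- `R_W(X) = X W`. -/
def rightMul (W : E →L[ℂ] E) : (E →L[ℂ] E) →L[ℂ] (E →L[ℂ] E) :=
  (ContinuousLinearMap.mul ℂ (E →L[ℂ] E)).flip W

theorem tr_add (X Y : E →L[ℂ] E) : tr (X + Y) = tr X + tr Y := by simp [tr]

theorem tr_smul (c : ℂ) (X : E →L[ℂ] E) : tr (c • X) = c * tr X := by simp [tr]

theorem tr_mul_comm (X Y : E →L[ℂ] E) : tr (X * Y) = tr (Y * X) :=
  LinearMap.trace_mul_comm ℂ (X : E →ₗ[ℂ] E) (Y : E →ₗ[ℂ] E)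

variable [FiniteDimensional ℂ E] [CompleteSpace E]

/-- The matrix unit `|e_i⟩⟨e_j|` in a fixed orthonormal basis. -/
def matUnit (i j : Fin (Module.finrank ℂ E)) : E →L[ℂ] E :=
  InnerProductSpace.rankOne ℂ (stdOrthonormalBasis ℂ E i) (stdOrthonormalBasis ℂ E j)

/-- The adjoint `T†` of a super-operator for the Hilbert-Schmidt inner product
`⟨X, Y⟩ = Tr[X† Y]`; see `tr_star_mul_hsAdjoint`. -/
def hsAdjoint (T : (E →L[ℂ] E) →L[ℂ] (E →L[ℂ] E)) : (E →L[ℂ] E) →L[ℂ] (E →L[ℂ] E) :=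
  LinearMap.toContinuousLinearMap
    { toFun := fun X => ∑ i, ∑ j, tr (star (T (matUnit i j)) * X) • matUnit i j
      map_add' := fun X Y => by
        simp [tr, mul_add, add_smul, Finset.sum_add_distrib]
      map_smul' := fun c X => by
        simp [tr, Finset.smul_sum, smul_smul] }

theorem tr_star_mul_hsAdjoint (T : (E →L[ℂ] E) →L[ℂ] (E →L[ℂ] E)) (X Y : E →L[ℂ] E) :
    tr (star (T X) * Y) = tr (star X * hsAdjoint T Y) := by
  have h1 : X = ∑ i, ∑ j, inner ℂ (stdOrthonormalBasis ℂ E i) (X (stdOrthonormalBasis ℂ E j)) •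
      matUnit i j := by
    apply ContinuousLinearMap.coe_injective
    refine (stdOrthonormalBasis ℂ E).toBasis.ext fun k => ?_
    simp only [OrthonormalBasis.coe_toBasis, ContinuousLinearMap.coe_coe,
      sum_apply, smul_apply, matUnit,
      InnerProductSpace.rankOne_apply, orthonormal_iff_ite.1 (stdOrthonormalBasis ℂ E).orthonormal]
    simp [(stdOrthonormalBasis ℂ E).sum_repr']
  have h2 : ∀ i j, tr (star X * matUnit i j) = starRingEnd ℂ
      (inner ℂ (stdOrthonormalBasis ℂ E i) (X (stdOrthonormalBasis ℂ E j))) := by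
    intro i j
    have : star X * matUnit i j = InnerProductSpace.rankOne ℂ
        (star X (stdOrthonormalBasis ℂ E i)) (stdOrthonormalBasis ℂ E j) := by
      ext v; simp [matUnit]
    rw [this, tr, InnerProductSpace.trace_rankOne, ContinuousLinearMap.star_eq_adjoint,
      ContinuousLinearMap.adjoint_inner_right, inner_conj_symm]
  have h3 : hsAdjoint T Y = ∑ i, ∑ j, tr (star (T (matUnit i j)) * Y) • matUnit i j := rfl
  have hs : ∀ (ι : Type) (s : Finset ι) (f : ι → E →L[ℂ] E), tr (∑ i ∈ s, f i) = ∑ i ∈ s, tr (f i) := by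
    intro ι s f; simp [tr]
  conv_lhs => rw [h1]
  rw [h3]
  simp only [map_sum, map_smul, star_sum, star_smul, Finset.sum_mul, Finset.mul_sum, smul_mul_assoc,
    mul_smul_comm, hs, tr_smul, h2]
  exact Finset.sum_congr rfl fun i _ => Finset.sum_congr rfl fun j _ => by
    rw [mul_comm, starRingEnd_apply]

end SuperOp

/-! ### The Gibbs state and the Lindbladian -/

section Lindbladian

variable {E : Type*} [NormedAddCommGroup E] [InnerProductSpace ℂ E] [FiniteDimensional ℂ E]
  [CompleteSpace E]

/-- The Gibbs state `σ = e^{-βH} / Tr e^{-βH}`. -/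
def gibbs (β : ℝ) (H : E →L[ℂ] E) : E →L[ℂ] E :=
  (tr (NormedSpace.exp (-(β : ℂ) • H)))⁻¹ • NormedSpace.exp (-(β : ℂ) • H)

/-- The real power `σ^s`, by the continuous functional calculus. -/
def gibbsPow (β : ℝ) (H : E →L[ℂ] E) (s : ℝ) : E →L[ℂ] E := CFC.rpow (gibbs β H) s

/-- `A(t) = e^{iHt} A e^{-iHt}`. -/
def heisenberg (H A : E →L[ℂ] E) (t : ℝ) : E →L[ℂ] E :=
  NormedSpace.exp ((Complex.I * t) • H) * A * NormedSpace.exp ((-(Complex.I * t)) • H)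

/-- `f(t) = e^{-t²/β²} / √(β √(π/2))`. -/
def filterFn (β t : ℝ) : ℝ :=
  Real.exp (-(t ^ 2 / β ^ 2)) / Real.sqrt (β * Real.sqrt (Real.pi / 2))

/-- `b₁(t) = 4 √π e^{1/8} (sech(2π ·) * (sin(-·) e^{-2 ·²}))(t)`, a convolution. -/
def b₁ (t : ℝ) : ℝ :=
  4 * Real.sqrt Real.pi * Real.exp (1 / 8) *
    ∫ s : ℝ, 1 / Real.cosh (2 * Real.pi * s) *
      (Real.sin (-(t - s)) * Real.exp (-2 * (t - s) ^ 2))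

/-- `b₂(t) = e^{-4t² - 2it} / (2 π^{3/2})`. -/
def b₂ (t : ℝ) : ℂ :=
  1 / (2 * Real.pi ^ (3 / 2 : ℝ) : ℝ) * Complex.exp (-4 * (t : ℂ) ^ 2 - 2 * Complex.I * t)

/-- `η(ω) = e^{-(βω+1)²/2}`. -/
def eta (β ω : ℝ) : ℝ := Real.exp (-(β * ω + 1) ^ 2 / 2)

/-- `A(ω) = (2π)^{-1/2} ∫ A(t) e^{-iωt} f(t) dt`. -/
def jump (β : ℝ) (H A : E →L[ℂ] E) (ω : ℝ) : E →L[ℂ] E :=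
  (1 / Real.sqrt (2 * Real.pi) : ℂ) •
    ∫ t : ℝ, (Complex.exp (-(Complex.I * ω * t)) * (filterFn β t : ℂ)) • heisenberg H A t

/-- `∫ dt b₁(t) ∫ dt' b₂(t') A(β(t'-t))† A(-β(t+t'))`. -/
def coherent (β : ℝ) (H A : E →L[ℂ] E) : E →L[ℂ] E :=
  ∫ t : ℝ, (b₁ t : ℂ) • ∫ t' : ℝ, b₂ t' •
    (star (heisenberg H A (β * (t' - t))) * heisenberg H A (-β * (t + t')))

/-- `ρ ↦ A ρ A† - ½ {A† A, ρ}`. -/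
def dissipator (A : E →L[ℂ] E) : (E →L[ℂ] E) →L[ℂ] (E →L[ℂ] E) :=
  leftMul A * rightMul (star A) - (1 / 2 : ℂ) • (leftMul (star A * A) + rightMul (star A * A))

/-- The Lindbladian
`ℒ(ρ) = -i[B,ρ] + ∑_j ∫ η(ω) (A_j(ω) ρ A_j(ω)† - ½{A_j(ω)† A_j(ω), ρ}) dω`, `B = ∑_j B_j`. -/
def lindbladian {m : ℕ} (β : ℝ) (H : E →L[ℂ] E) (γ : Fin m → E →L[ℂ] E) :
    (E →L[ℂ] E) →L[ℂ] (E →L[ℂ] E) :=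
  (-Complex.I) • (leftMul (∑ j, coherent β H (γ j)) - rightMul (∑ j, coherent β H (γ j))) +
    ∑ j, ∫ ω : ℝ, (eta β ω : ℂ) • dissipator (jump β H (γ j) ω)

end Lindbladian

/-! ### Third quantization and the parent Hamiltonian -/

section ThirdQ

variable {E : Type*} [NormedAddCommGroup E] [InnerProductSpace ℂ E] [FiniteDimensional ℂ E]
  [CompleteSpace E]

/-- The enlarged Hilbert space `H'` with orthonormal basis `v_α`, `α ∈ {0,1}^{2n}`. -/
abbrev Enlarged (n : ℕ) : Type := EuclideanSpace ℂ (Fin (2 * n) → Fin 2)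

/-- The linear map `φ : B(E) → H'` with `φ(γ₁^{α₁} ⋯ γ_{2n}^{α_{2n}}) = v_α`
(see `phi_monomial`); in coordinates `φ(X)_α = 2^{-n} Tr[(γ^α)† X]`. -/
def phi {n : ℕ} (γ : Fin (2 * n) → E →L[ℂ] E) : (E →L[ℂ] E) →L[ℂ] Enlarged n :=
  LinearMap.toContinuousLinearMap
    { toFun := fun X => WithLp.toLp 2 fun α => (2 ^ n : ℂ)⁻¹ * tr (star (monomial γ α) * X)
      map_add' := fun X Y => by
        ext α; simp [tr, mul_add]
      map_smul' := fun c X => by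
        ext α; simp [tr, mul_left_comm] }

/-- The inverse `φ⁻¹ : H' → B(E)`, `v_α ↦ γ₁^{α₁} ⋯ γ_{2n}^{α_{2n}}`. -/
def phiInv {n : ℕ} (γ : Fin (2 * n) → E →L[ℂ] E) : Enlarged n →L[ℂ] (E →L[ℂ] E) :=
  LinearMap.toContinuousLinearMap
    { toFun := fun v => ∑ α, v α • monomial γ α
      map_add' := fun v w => by simp [add_smul, Finset.sum_add_distrib]
      map_smul' := fun c v => by simp [Finset.smul_sum, smul_smul] }

theorem IsMajorana.tr_star_mul_monomial {n : ℕ} {γ : Fin (2 * n) → E →L[ℂ] E}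
    (h : IsMajorana n γ) (α α' : Fin (2 * n) → Fin 2) :
    tr (star (monomial γ α) * monomial γ α') = if α = α' then 2 ^ n else 0 := by
  split_ifs with hα
  · subst hα
    rw [(Unitary.mem_iff.1 (h.monomial_mem_unitary α)).1, tr]
    have : ((1 : E →L[ℂ] E) : E →ₗ[ℂ] E) = 1 := rfl
    rw [this, LinearMap.trace_one, h.finrank_eq]
    simp
  · have hconj : ∀ j, tr (star (monomial γ α) * monomial γ α') =
        (-1 : ℂ) ^ (weight α + (α j : ℕ) + (weight α' + (α' j : ℕ))) *
          tr (star (monomial γ α) * monomial γ α') := by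
      intro j
      have e1 := congrArg star (h.mul_monomial j α)
      rw [star_mul, star_smul, star_mul, (h.isSelfAdjoint j).star_eq] at e1
      have e2 := h.mul_monomial j α'
      have e3 : star (monomial γ α) * monomial γ α' =
          (star (monomial γ α) * γ j) * (γ j * monomial γ α') := by
        rw [mul_assoc, ← mul_assoc (γ j), h.mul_self, one_mul]
      conv_lhs => rw [e3, e1, e2]
      rw [smul_mul_smul_comm, tr_smul, ← mul_assoc, tr_mul_comm, ← mul_assoc, ← mul_assoc,
        h.mul_self, one_mul, star_pow, star_neg, star_one, ← pow_add]
    have hj : ∃ j, Odd (weight α + (α j : ℕ) + (weight α' + (α' j : ℕ))) := by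
      by_contra! hne
      simp only [Nat.not_odd_iff_even] at hne
      obtain ⟨k, hk⟩ := Function.ne_iff.1 hα
      have hk' : (α k : ℕ) ≠ (α' k : ℕ) := fun e => hk (Fin.ext e)
      have hodd : Odd (weight α + weight α') := by
        have := hne k
        rw [Nat.even_iff] at this; rw [Nat.odd_iff]; omega
      have hall : ∀ j, (α j : ℕ) + (α' j : ℕ) = 1 := by
        intro j
        have := hne j
        rw [Nat.even_iff] at this; rw [Nat.odd_iff] at hodd; omega
      have : weight α + weight α' = 2 * n := by
        rw [weight, weight, ← Finset.sum_add_distrib, Finset.sum_congr rfl fun j _ => hall j]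
        simp
      rw [this, Nat.odd_iff] at hodd
      omega
    obtain ⟨j, hj⟩ := hj
    have := hconj j
    rw [hj.neg_one_pow] at this
    linear_combination this / 2

theorem phi_phiInv {n : ℕ} {γ : Fin (2 * n) → E →L[ℂ] E} (h : IsMajorana n γ) (v : Enlarged n) :
    phi γ (phiInv γ v) = v := by
  have hs : ∀ f : (Fin (2 * n) → Fin 2) → E →L[ℂ] E, tr (∑ i, f i) = ∑ i, tr (f i) := by
    intro f; simp [tr]
  ext α
  change (2 ^ n : ℂ)⁻¹ * tr (star (monomial γ α) * ∑ α', v α' • monomial γ α') = v α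
  simp only [Finset.mul_sum, mul_smul_comm, hs, tr_smul, h.tr_star_mul_monomial]
  simp [mul_comm (v α)]

theorem phiInv_phi {n : ℕ} {γ : Fin (2 * n) → E →L[ℂ] E} (h : IsMajorana n γ) (X : E →L[ℂ] E) :
    phiInv γ (phi γ X) = X := by
  have hsurj : Function.Surjective (phi γ).toLinearMap := fun v => ⟨_, phi_phiInv h v⟩
  have hdim : Module.finrank ℂ (E →L[ℂ] E) = Module.finrank ℂ (Enlarged n) := by
    rw [← (LinearMap.toContinuousLinearMap : (E →ₗ[ℂ] E) ≃ₗ[ℂ] (E →L[ℂ] E)).finrank_eq,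
      Module.finrank_linearMap, h.finrank_eq]
    simp [← pow_add, two_mul]
  have hinj := (LinearMap.injective_iff_surjective_of_finrank_eq_finrank hdim).2 hsurj
  exact hinj (phi_phiInv h (phi γ X))

theorem phi_monomial {n : ℕ} {γ : Fin (2 * n) → E →L[ℂ] E} (h : IsMajorana n γ)
    (α : Fin (2 * n) → Fin 2) : phi γ (monomial γ α) = EuclideanSpace.single α 1 := by
  ext α'
  change (2 ^ n : ℂ)⁻¹ * tr (star (monomial γ α') * monomial γ α) = _
  rw [h.tr_star_mul_monomial]
  by_cases hα : α' = α <;> simp [hα]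

/-- The `a`-fermion parity operator `(-1)^n̂` on `H'`: `v_α ↦ (-1)^{|α|} v_α`. -/
def aParity (n : ℕ) : Enlarged n →L[ℂ] Enlarged n :=
  LinearMap.toContinuousLinearMap
    { toFun := fun v => WithLp.toLp 2 fun α => (-1 : ℂ) ^ weight α * v α
      map_add' := fun v w => by ext α; simp [mul_add]
      map_smul' := fun c v => by ext α; simp [mul_left_comm] }

/-- The component of a super-operator in the span of the `L_W R_{W'}` with `W'` even. -/
def rightEvenPart {n : ℕ} (γ : Fin (2 * n) → E →L[ℂ] E)
    (T : (E →L[ℂ] E) →L[ℂ] (E →L[ℂ] E)) : (E →L[ℂ] E) →L[ℂ] (E →L[ℂ] E) :=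
  (1 / 2 : ℂ) • (T + rightMul (star (parityOp γ)) * T * rightMul (parityOp γ))

/-- The component of a super-operator in the span of the `L_W R_{W'}` with `W'` odd. -/
def rightOddPart {n : ℕ} (γ : Fin (2 * n) → E →L[ℂ] E)
    (T : (E →L[ℂ] E) →L[ℂ] (E →L[ℂ] E)) : (E →L[ℂ] E) →L[ℂ] (E →L[ℂ] E) :=
  (1 / 2 : ℂ) • (T - rightMul (star (parityOp γ)) * T * rightMul (parityOp γ))

/-- The linear map `Φ : B(B(E)) → B(H')` with `Φ(L_W R_{W'}) = φ ∘ L_W R_{W'} ∘ φ⁻¹` for even `W'`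
and `Φ(L_W R_{W'}) = (φ ∘ L_W R_{W'} ∘ φ⁻¹) (-1)^n̂` for odd `W'`; see `Phi_of_even`,
`Phi_of_odd` and `Phi_mul`. -/
def Phi {n : ℕ} (γ : Fin (2 * n) → E →L[ℂ] E) (T : (E →L[ℂ] E) →L[ℂ] (E →L[ℂ] E)) :
    Enlarged n →L[ℂ] Enlarged n :=
  phi γ ∘L rightEvenPart γ T ∘L phiInv γ + phi γ ∘L rightOddPart γ T ∘L phiInv γ ∘L aParity n

theorem Phi_of_even {n : ℕ} {γ : Fin (2 * n) → E →L[ℂ] E} (h : IsMajorana n γ)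
    (W : E →L[ℂ] E) {W' : E →L[ℂ] E} (hW' : W' ∈ evenOps γ) :
    Phi γ (leftMul W * rightMul W') = phi γ ∘L (leftMul W * rightMul W') ∘L phiInv γ := by
  have h0 : rightMul (star (parityOp γ)) * (leftMul W * rightMul W') * rightMul (parityOp γ) =
      leftMul W * rightMul W' := by
    ext1 X
    change W * (X * parityOp γ * W') * star (parityOp γ) = W * (X * W')
    have := h.parityOp_conj_of_even hW'
    simp only [mul_assoc] at this ⊢
    rw [this]
  rw [Phi, rightEvenPart, rightOddPart, h0, ← two_smul ℂ, smul_smul]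
  simp

theorem Phi_of_odd {n : ℕ} {γ : Fin (2 * n) → E →L[ℂ] E} (h : IsMajorana n γ)
    (W : E →L[ℂ] E) {W' : E →L[ℂ] E} (hW' : W' ∈ oddOps γ) :
    Phi γ (leftMul W * rightMul W') =
      phi γ ∘L (leftMul W * rightMul W') ∘L phiInv γ ∘L aParity n := by
  have h0 : rightMul (star (parityOp γ)) * (leftMul W * rightMul W') * rightMul (parityOp γ) =
      -(leftMul W * rightMul W') := by
    ext1 X
    change W * (X * parityOp γ * W') * star (parityOp γ) = -(W * (X * W'))
    have := h.parityOp_conj_of_odd hW'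
    simp only [mul_assoc] at this ⊢
    rw [this]
    simp
  rw [Phi, rightEvenPart, rightOddPart, h0, sub_neg_eq_add, ← two_smul ℂ, smul_smul]
  simp
theorem one_mem_evenOps {n : ℕ} (γ : Fin (2 * n) → E →L[ℂ] E) : (1 : E →L[ℂ] E) ∈ evenOps γ :=
  Submodule.subset_span ⟨fun _ => 0, by simp [weight], by simp [monomial]⟩

theorem leftMul_one : leftMul (1 : E →L[ℂ] E) = 1 := by ext1 X; exact one_mul X

theorem rightMul_one : rightMul (1 : E →L[ℂ] E) = 1 := by ext1 X; exact mul_one X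

theorem Phi_mul {n : ℕ} {γ : Fin (2 * n) → E →L[ℂ] E} (h : IsMajorana n γ)
    (W : E →L[ℂ] E) {W' : E →L[ℂ] E} (hW' : W' ∈ evenOps γ ∨ W' ∈ oddOps γ) :
    Phi γ (leftMul W * rightMul W') = Phi γ (leftMul W) * Phi γ (rightMul W') := by
  have hL := Phi_of_even h W (one_mem_evenOps γ)
  rw [rightMul_one, mul_one] at hL
  rcases hW' with hW' | hW'
  · have hR := Phi_of_even h 1 hW'
    rw [leftMul_one, one_mul] at hR
    rw [Phi_of_even h W hW', hL, hR]
    ext1 v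
    simp [phiInv_phi h]
  · have hR := Phi_of_odd h 1 hW'
    rw [leftMul_one, one_mul] at hR
    rw [Phi_of_odd h W hW', hL, hR]
    ext1 v
    simp [phiInv_phi h]

/-- `Γ_s(X) = σ^s X σ^s`; thus `Γ = Γ_{1/4}` and `Γ⁻¹ = Γ_{-1/4}`. -/
def gibbsConj (β : ℝ) (H : E →L[ℂ] E) (s : ℝ) : (E →L[ℂ] E) →L[ℂ] (E →L[ℂ] E) :=
  leftMul (gibbsPow β H s) * rightMul (gibbsPow β H s)

/-- The parent Hamiltonian `Φ(Γ ∘ ℒ† ∘ Γ⁻¹)`. -/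
def parentHamiltonian {n : ℕ} (β : ℝ) (H : E →L[ℂ] E) (γ : Fin (2 * n) → E →L[ℂ] E) :
    Enlarged n →L[ℂ] Enlarged n :=
  Phi γ (gibbsConj β H (1 / 4) * hsAdjoint (lindbladian β H γ) * gibbsConj β H (-(1 / 4)))

end ThirdQ

/-- The set of negative eigenvalues of a linear operator. -/
def negEigenvalues {V : Type*} [AddCommGroup V] [Module ℂ V] (T : Module.End ℂ V) : Set ℝ :=
  {r | r < 0 ∧ T.HasEigenvalue (r : ℂ)}

end ThirdQuantization

end

/-! Split each Majorana operator by the spectral projections `Q i` of `H` into components `Q i * γ j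
* Q k`, each rotating under the Heisenberg flow with a single Bohr frequency ν. Every time or
frequency integral in `lindbladian` then becomes a Fourier transform at Bohr frequencies. The
dissipator produces the matrix `kossakowski`, written α(ν, ν') below, and the coherent term produces
α multiplied by tanh(β(ν - ν')/4).

Conjugation by σ^{1/4} multiplies each component by a power of e^{βν}. The tanh is exactly what
turns the drift coefficients into -α / (2 cosh), symmetric in ν, ν' (`driftCoeff_mul_exp`). The
shift in η makes the jump coefficients invariant under ν ↦ -ν (`parentJumpCoeff_neg`), which
compensates for taking adjoints of components. Hence Γ ∘ ℒ† ∘ Γ⁻¹ is symmetric for the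
Hilbert-Schmidt product (`tr_star_symmetrized_mul`). It also commutes with conjugation θ by the
parity operator P, and these two properties make its image under `Phi` self-adjoint on both parity
sectors (`isSelfAdjoint_Phi`).

On even operators `Phi γ T` is just `T` transported by `phi` (`Phi_phi_of_even`). So φ ∘ Γ is an
injective intertwiner from ℒ† on the even operators to the parent Hamiltonian, which therefore
inherits the eigenvalues with at least their multiplicities. This gives the comparison of gaps and
kernels. The identity is a zero mode. A negative eigenvalue exists because P is even and
anticommutes with every component, which makes ⟨ΓP, Γℒ†P⟩ strictly negative
(`tr_symmetrized_parityOp_neg`). -/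

section
open Complex

/-! ### Fourier transforms of Gaussians and of the hyperbolic secant. -/

theorem integral_cexp_real_quadratic {b : ℝ} (hb : 0 < b) (c d : ℂ) :
    ∫ x : ℝ, cexp (-(b : ℂ) * x ^ 2 + c * x + d) =
      (Real.sqrt (Real.pi / b) : ℂ) * cexp (d + c ^ 2 / (4 * b)) := by
  rw [integral_cexp_quadratic (by simpa using hb), neg_neg, mul_neg, div_neg, sub_neg_eq_add,
    Real.sqrt_eq_rpow, Complex.ofReal_cpow (by positivity)]
  push_cast
  rfl

theorem integrable_cexp_real_quadratic {b : ℝ} (hb : 0 < b) (c d : ℂ) :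
    Integrable fun x : ℝ => cexp (-(b : ℂ) * x ^ 2 + c * x + d) :=
  integrable_cexp_quadratic (by simpa using hb) c d

/-- The Beta integral in logistic coordinates. -/
theorem betaIntegral_eq_sigmoid (u v : ℂ) :
    betaIntegral u v = ∫ t : ℝ, (Real.sigmoid t : ℂ) ^ u * (Real.sigmoid (-t) : ℂ) ^ v := by
  rw [betaIntegral, intervalIntegral.integral_of_le zero_le_one, integral_Ioc_eq_integral_Ioo,
    ← Real.range_sigmoid, ← Set.image_univ,
    integral_image_eq_integral_abs_deriv_smul MeasurableSet.univ
      (fun x _ => (Real.hasDerivAt_sigmoid x).hasDerivWithinAt) Real.sigmoid_injective.injOn,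
    setIntegral_univ]
  refine integral_congr_ae (.of_forall fun t => ?_)
  have h1 := Real.sigmoid_pos t
  have h2 := Real.sigmoid_pos (-t)
  have h1' : (Real.sigmoid t : ℂ) ≠ 0 := by exact_mod_cast h1.ne'
  have h2' : (Real.sigmoid (-t) : ℂ) ≠ 0 := by exact_mod_cast h2.ne'
  have h3 : (1 : ℂ) - (Real.sigmoid t : ℂ) = (Real.sigmoid (-t) : ℂ) := by
    rw [Real.sigmoid_neg]; push_cast; ring
  simp only []
  rw [← Real.sigmoid_neg, abs_of_pos (by positivity), h3, Complex.cpow_sub _ _ h1',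
    Complex.cpow_sub _ _ h2', Complex.cpow_one, Complex.cpow_one, Complex.real_smul]
  push_cast
  field_simp

/-- The logarithm of the sigmoid at ±t is ±t/2 - log(2 cosh(t/2)): the odd part carries the phase,
the common even part the secant. -/
theorem sigmoid_cpow_mul (a t : ℝ) :
    (Real.sigmoid t : ℂ) ^ (1 / 2 + I * a) * (Real.sigmoid (-t) : ℂ) ^ (1 / 2 - I * a) =
      cexp (I * a * t) * (1 / (2 * Real.cosh (t / 2)) : ℝ) := by
  have h1 := Real.sigmoid_pos t
  have h2 := Real.sigmoid_pos (-t)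
  have e1 : Real.log (Real.sigmoid t) = t / 2 - Real.log (2 * Real.cosh (t / 2)) := by
    rw [Real.sigmoid_def, Real.log_inv, eq_sub_iff_add_eq, neg_add_eq_iff_eq_add,
      ← Real.log_exp (t / 2), ← Real.log_mul (by positivity) (by positivity), Real.log_exp]
    congr 1
    rw [Real.cosh_eq, add_mul, ← Real.exp_add]
    ring_nf
  have e2 : Real.log (Real.sigmoid (-t)) = -t / 2 - Real.log (2 * Real.cosh (t / 2)) := by
    rw [Real.sigmoid_def, Real.log_inv, eq_sub_iff_add_eq, neg_add_eq_iff_eq_add,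
      ← Real.log_exp (-t / 2), ← Real.log_mul (by positivity) (by positivity)]
    congr 1
    rw [Real.cosh_eq, add_mul, ← Real.exp_add]
    ring_nf
  have e3 : (1 / (2 * Real.cosh (t / 2)) : ℝ) = Real.exp (- Real.log (2 * Real.cosh (t / 2))) := by
    rw [Real.exp_neg, Real.exp_log (by positivity), one_div]
  rw [Complex.cpow_def_of_ne_zero (by exact_mod_cast h1.ne'),
    Complex.cpow_def_of_ne_zero (by exact_mod_cast h2.ne'), ← Complex.ofReal_log h1.le,
    ← Complex.ofReal_log h2.le, e1, e2, e3, Complex.ofReal_exp, ← Complex.exp_add,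
    ← Complex.exp_add]
  push_cast
  ring_nf

/-- This is the Beta integral B(1/2 + ia, 1/2 - ia). Since the arguments sum to 1, Euler's
reflection formula gives π / sin(π/2 + iπa). -/
theorem integral_cexp_div_cosh (a : ℝ) :
    ∫ t : ℝ, cexp (I * a * t) * (1 / (2 * Real.cosh (t / 2)) : ℝ) =
      Real.pi / Real.cosh (Real.pi * a) := by
  simp_rw [← sigmoid_cpow_mul]
  rw [← betaIntegral_eq_sigmoid]
  have h := Gamma_mul_Gamma_eq_betaIntegral (s := 1 / 2 + I * a) (t := 1 / 2 - I * a)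
    (by simp) (by simp)
  rw [show (1 / 2 + I * a + (1 / 2 - I * a) : ℂ) = 1 by ring, Gamma_one, one_mul] at h
  rw [← h, show (1 / 2 - I * a : ℂ) = 1 - (1 / 2 + I * a) by ring, Gamma_mul_Gamma_one_sub]
  rw [show (Real.pi * (1 / 2 + I * a) : ℂ) = (Real.pi * a : ℂ) * I + Real.pi / 2 by ring,
    Complex.sin_add_pi_div_two, Complex.cos_mul_I]
  push_cast
  rfl

theorem integral_cexp_sech (d : ℝ) :
    ∫ t : ℝ, cexp (I * d * t) * (1 / Real.cosh (2 * Real.pi * t) : ℝ) =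
      1 / (2 * Real.cosh (d / 4)) := by
  -- The frequency d / (4π) is the one that the substitution t ↦ 4πt turns into d, while cosh(t/2)
  -- becomes cosh(2πt).
  have h := integral_cexp_div_cosh (d / (4 * Real.pi))
  have h2 := Measure.integral_comp_mul_left
    (fun t : ℝ => cexp (I * (d / (4 * Real.pi) : ℝ) * t) *
      (1 / (2 * Real.cosh (t / 2)) : ℝ)) (4 * Real.pi)
  rw [h] at h2
  have hp := Real.pi_pos
  rw [abs_of_pos (by positivity)] at h2
  have e : ∀ t : ℝ, cexp (I * (d / (4 * Real.pi) : ℝ) * (4 * Real.pi * t : ℝ)) *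
      (1 / (2 * Real.cosh (4 * Real.pi * t / 2)) : ℝ) =
      (1 / 2 : ℂ) * (cexp (I * d * t) * (1 / Real.cosh (2 * Real.pi * t) : ℝ)) := by
    intro t
    have hp' : (Real.pi : ℂ) ≠ 0 := by exact_mod_cast hp.ne'
    rw [show (I * (d / (4 * Real.pi) : ℝ) * (4 * Real.pi * t : ℝ) : ℂ) = I * d * t by
        push_cast; field_simp,
      show 4 * Real.pi * t / 2 = 2 * Real.pi * t by ring]
    push_cast
    ring
  simp_rw [e] at h2
  rw [integral_const_mul] at h2
  have hp' : (Real.pi : ℂ) ≠ 0 := by exact_mod_cast hp.ne'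
  rw [show Real.pi * (d / (4 * Real.pi)) = d / 4 by field_simp, Complex.real_smul] at h2
  have h3 : (Real.cosh (d / 4) : ℂ) ≠ 0 := by exact_mod_cast (Real.cosh_pos _).ne'
  set J := ∫ t : ℝ, cexp (I * d * t) * (1 / Real.cosh (2 * Real.pi * t) : ℝ) with hJ
  rw [show J = 2 * (1 / 2 * J) by ring, h2]
  push_cast at h3 ⊢
  field_simp
  norm_num

/-- The Bochner integral of a non-integrable function is 0 by convention, whereas the value just
computed is positive. -/
theorem integrable_cexp_sech (d : ℝ) :
    Integrable fun t : ℝ => cexp (I * d * t) * (1 / Real.cosh (2 * Real.pi * t) : ℝ) := by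
  by_contra h
  have h1 := integral_cexp_sech d
  rw [integral_undef h] at h1
  have h2 := Real.cosh_pos (d / 4)
  have h3 : (1 / (2 * Real.cosh (d / 4)) : ℝ) = 0 := by exact_mod_cast h1.symm
  exact (by positivity : (1 / (2 * Real.cosh (d / 4)) : ℝ) ≠ 0) h3

/-- Writing the sine through exponentials shifts the frequency by ±1, leaving two pure Gaussian
integrands. -/
theorem cexp_mul_sin_mul_gaussian (d r : ℝ) :
    cexp (I * d * r) * (Real.sin (-r) * Real.exp (-2 * r ^ 2) : ℝ) =
      -(I / 2) * cexp (-((2 : ℝ) : ℂ) * r ^ 2 + I * (d - 1) * r + 0) -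
        -(I / 2) * cexp (-((2 : ℝ) : ℂ) * r ^ 2 + I * (d + 1) * r + 0) := by
  rw [Real.sin_neg]
  push_cast
  rw [Complex.sin, show cexp (-2 * (r : ℂ) ^ 2 + I * (d - 1) * r + 0) =
      cexp (-2 * (r : ℂ) ^ 2) * cexp (I * d * r) * cexp (-r * I) by
      rw [← Complex.exp_add, ← Complex.exp_add]; ring_nf,
    show cexp (-2 * (r : ℂ) ^ 2 + I * (d + 1) * r + 0) =
      cexp (-2 * (r : ℂ) ^ 2) * cexp (I * d * r) * cexp (r * I) by
      rw [← Complex.exp_add, ← Complex.exp_add]; ring_nf]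
  ring

theorem integrable_cexp_sin_gaussian (d : ℝ) :
    Integrable fun r : ℝ => cexp (I * d * r) * (Real.sin (-r) * Real.exp (-2 * r ^ 2) : ℝ) := by
  simp_rw [cexp_mul_sin_mul_gaussian]
  exact ((integrable_cexp_real_quadratic two_pos _ _).const_mul _).sub
    ((integrable_cexp_real_quadratic two_pos _ _).const_mul _)

theorem integral_cexp_sin_gaussian (d : ℝ) :
    ∫ r : ℝ, cexp (I * d * r) * (Real.sin (-r) * Real.exp (-2 * r ^ 2) : ℝ) =
      -I * (Real.sqrt (Real.pi / 2) * Real.exp (-(d ^ 2 + 1) / 8) * Real.sinh (d / 4) : ℝ) := by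
  simp_rw [cexp_mul_sin_mul_gaussian]
  rw [integral_sub ((integrable_cexp_real_quadratic two_pos _ _).const_mul _)
    ((integrable_cexp_real_quadratic two_pos _ _).const_mul _), integral_const_mul,
    integral_const_mul, integral_cexp_real_quadratic two_pos, integral_cexp_real_quadratic two_pos]
  push_cast
  rw [Complex.sinh,
    show (0 + (I * (d - 1)) ^ 2 / (4 * 2) : ℂ) = -(d ^ 2 + 1) / 8 + d / 4 by
      rw [mul_pow, I_sq]; ring,
    show (0 + (I * (d + 1)) ^ 2 / (4 * 2) : ℂ) = -(d ^ 2 + 1) / 8 + -(d / 4) by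
      rw [mul_pow, I_sq]; ring, Complex.exp_add, Complex.exp_add]
  ring

namespace ThirdQuantization

/-! ### Transforms of the kernels b₁, b₂, f, and the coefficients they produce. -/

/-- A character is multiplicative, so it can be distributed over the two factors of the convolution;
the integral then factorizes. -/
theorem cexp_mul_b₁ (d t : ℝ) :
    cexp (I * d * t) * b₁ t = (4 * Real.sqrt Real.pi * Real.exp (1 / 8) : ℝ) *
      convolution (fun s : ℝ => cexp (I * d * s) * (1 / Real.cosh (2 * Real.pi * s) : ℝ))
        (fun r : ℝ => cexp (I * d * r) * (Real.sin (-r) * Real.exp (-2 * r ^ 2) : ℝ))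
        (ContinuousLinearMap.mul ℂ ℂ) volume t := by
  rw [b₁, convolution, Complex.ofReal_mul, mul_left_comm, ← integral_complex_ofReal,
    ← integral_const_mul]
  congr 1
  refine integral_congr_ae (.of_forall fun s => ?_)
  simp only [ContinuousLinearMap.mul_apply']
  rw [show cexp (I * d * t) = cexp (I * d * s) * cexp (I * d * (t - s : ℝ)) by
    rw [← Complex.exp_add]; push_cast; ring_nf]
  push_cast
  ring

theorem integrable_cexp_mul_b₁ (d : ℝ) : Integrable fun t : ℝ => cexp (I * d * t) * b₁ t := by
  simp_rw [cexp_mul_b₁]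
  exact ((integrable_cexp_sech d).integrable_convolution _
    (integrable_cexp_sin_gaussian d)).const_mul _

/-- The Fourier transform of `b₁`. -/
theorem integral_cexp_mul_b₁ (d : ℝ) :
    ∫ t : ℝ, cexp (I * d * t) * b₁ t =
      -I * (Real.pi * Real.sqrt 2 * Real.exp (-d ^ 2 / 8) * Real.tanh (d / 4) : ℝ) := by
  simp_rw [cexp_mul_b₁]
  rw [integral_const_mul, integral_convolution _ (integrable_cexp_sech d)
    (integrable_cexp_sin_gaussian d), ContinuousLinearMap.mul_apply', integral_cexp_sech,
    integral_cexp_sin_gaussian]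
  -- The prefactor e^{1/8} cancels the Gaussian cost of the unit frequency shift, and sinh from the
  -- sine over cosh from the secant gives the tanh.
  have h : 4 * Real.sqrt Real.pi * Real.exp (1 / 8) * (1 / (2 * Real.cosh (d / 4)) *
      (Real.sqrt (Real.pi / 2) * Real.exp (-(d ^ 2 + 1) / 8) * Real.sinh (d / 4))) =
      Real.pi * Real.sqrt 2 * Real.exp (-d ^ 2 / 8) * Real.tanh (d / 4) := by
    have h1 := Real.cosh_pos (d / 4)
    have h2 : Real.exp (-d ^ 2 / 8) = Real.exp (1 / 8) * Real.exp (-(d ^ 2 + 1) / 8) := by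
      rw [← Real.exp_add]; ring_nf
    have h3 : Real.sqrt Real.pi * Real.sqrt (Real.pi / 2) * 2 = Real.pi * Real.sqrt 2 := by
      rw [Real.sqrt_div Real.pi_pos.le]
      have h4 := Real.mul_self_sqrt Real.pi_pos.le
      have h5 := Real.mul_self_sqrt (zero_le_two (α := ℝ))
      field_simp
      linear_combination 2 * h4 - Real.pi * h5
    rw [h2, ← h3, Real.tanh_eq_sinh_div_cosh]
    field_simp
    norm_num
  rw [← h]
  push_cast
  ring

theorem cexp_mul_b₂ (s t : ℝ) :
    cexp (-(I * s * t)) * b₂ t = 1 / (2 * Real.pi ^ (3 / 2 : ℝ) : ℝ) *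
      cexp (-((4 : ℝ) : ℂ) * t ^ 2 + -(I * (s + 2)) * t + 0) := by
  rw [b₂, mul_left_comm, ← Complex.exp_add]
  push_cast
  ring_nf

theorem integrable_cexp_mul_b₂ (s : ℝ) : Integrable fun t : ℝ => cexp (-(I * s * t)) * b₂ t := by
  simp_rw [cexp_mul_b₂]
  exact (integrable_cexp_real_quadratic four_pos _ _).const_mul _

/-- The Fourier transform of `b₂`. -/
theorem integral_cexp_mul_b₂ (s : ℝ) :
    ∫ t : ℝ, cexp (-(I * s * t)) * b₂ t =
      (1 / (4 * Real.pi) * Real.exp (-(s + 2) ^ 2 / 16) : ℝ) := by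
  simp_rw [cexp_mul_b₂]
  rw [integral_const_mul, integral_cexp_real_quadratic four_pos]
  have h1 : Real.pi ^ (3 / 2 : ℝ) = Real.pi * Real.sqrt Real.pi := by
    rw [Real.sqrt_eq_rpow, ← Real.rpow_one_add' Real.pi_pos.le (by norm_num)]
    norm_num
  have h2 : Real.sqrt (Real.pi / 4) = Real.sqrt Real.pi / 2 := by
    rw [Real.sqrt_div Real.pi_pos.le, show (4 : ℝ) = 2 ^ 2 by norm_num,
      Real.sqrt_sq zero_le_two]
  have h3 := Real.sqrt_pos.2 Real.pi_pos
  have h3' : (Real.sqrt Real.pi : ℂ) ≠ 0 := by exact_mod_cast h3.ne'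
  have h4 : (Real.pi : ℂ) ≠ 0 := by exact_mod_cast Real.pi_pos.ne'
  rw [h1, h2, show (0 + (-(I * (s + 2))) ^ 2 / (4 * (4 : ℝ)) : ℂ) = (-(s + 2) ^ 2 / 16 : ℝ) by
    push_cast; rw [neg_sq, mul_pow, I_sq]; ring, ← Complex.ofReal_exp]
  push_cast
  field_simp
  norm_num

/-- The amplitude of the Fourier transform of the filter function. -/
noncomputable def filterConst (β : ℝ) : ℝ :=
  Real.sqrt Real.pi * β / (Real.sqrt (2 * Real.pi) * Real.sqrt (β * Real.sqrt (Real.pi / 2)))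

/-- The Fourier transform of the filter function. -/
noncomputable def filterHat (β ω : ℝ) : ℝ := filterConst β * Real.exp (-(β * ω) ^ 2 / 4)

theorem filterConst_sq {β : ℝ} (hβ : 0 < β) : filterConst β ^ 2 = β / Real.sqrt (2 * Real.pi) := by
  have hp := Real.pi_pos
  have h1 : Real.sqrt (2 * Real.pi) = 2 * Real.sqrt (Real.pi / 2) := by
    rw [show 2 * Real.pi = 2 ^ 2 * (Real.pi / 2) by ring, Real.sqrt_mul (by positivity),
      Real.sqrt_sq zero_le_two]
  rw [filterConst, div_pow, mul_pow, mul_pow, Real.sq_sqrt hp.le, Real.sq_sqrt (by positivity),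
    Real.sq_sqrt (by positivity), h1]
  have h2 : 0 < Real.sqrt (Real.pi / 2) := by positivity
  field_simp

theorem cexp_mul_filterFn (β ω t : ℝ) :
    cexp (-(I * ω * t)) * filterFn β t = (1 / Real.sqrt (β * Real.sqrt (Real.pi / 2)) : ℝ) *
      cexp (-((1 / β ^ 2 : ℝ) : ℂ) * t ^ 2 + -(I * ω) * t + 0) := by
  rw [filterFn, div_eq_mul_one_div, Complex.ofReal_mul, ← mul_assoc, mul_comm, Complex.ofReal_exp,
    ← Complex.exp_add]
  push_cast
  ring_nf

theorem integrable_cexp_mul_filterFn {β : ℝ} (hβ : 0 < β) (ω : ℝ) :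
    Integrable fun t : ℝ => cexp (-(I * ω * t)) * filterFn β t := by
  simp_rw [cexp_mul_filterFn]
  exact (integrable_cexp_real_quadratic (by positivity) _ _).const_mul _

theorem integral_cexp_mul_filterFn {β : ℝ} (hβ : 0 < β) (ω : ℝ) :
    (1 / Real.sqrt (2 * Real.pi) : ℂ) * ∫ t : ℝ, cexp (-(I * ω * t)) * filterFn β t =
      filterHat β ω := by
  simp_rw [cexp_mul_filterFn]
  rw [integral_const_mul, integral_cexp_real_quadratic (by positivity), filterHat, filterConst]
  have h1 : Real.sqrt (Real.pi / (1 / β ^ 2)) = Real.sqrt Real.pi * β := by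
    rw [div_div_eq_mul_div, div_one, Real.sqrt_mul Real.pi_pos.le, Real.sqrt_sq hβ.le]
  have hb : (β : ℂ) ≠ 0 := by exact_mod_cast hβ.ne'
  rw [h1, show (0 + (-(I * ω)) ^ 2 / (4 * (1 / β ^ 2 : ℝ)) : ℂ) = (-(β * ω) ^ 2 / 4 : ℝ) by
    push_cast; rw [neg_sq, mul_pow, I_sq]; field_simp; ring, ← Complex.ofReal_exp]
  push_cast
  field_simp

/-- The coefficients `∫ η(ω) f̂(ω - ν) f̂(ω - ν') dω`. -/
noncomputable def kossakowski (β ν ν' : ℝ) : ℝ :=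
  1 / Real.sqrt 2 *
    Real.exp (-(β * ν + β * ν' + 2) ^ 2 / 16 - (β * ν - β * ν') ^ 2 / 8)

/-- A product of three Gaussians is a single Gaussian in ω; the two filter amplitudes enter only
through `filterConst β ^ 2`. -/
theorem eta_mul_filterHat_mul (β ν ν' ω : ℝ) :
    (eta β ω * (filterHat β (ω - ν) * filterHat β (ω - ν')) : ℂ) = (filterConst β ^ 2 : ℝ) *
      cexp (-((β ^ 2 : ℝ) : ℂ) * ω ^ 2 + (β * (β * ν + β * ν') / 2 - β) * ω +
        (-1 / 2 - ((β * ν) ^ 2 + (β * ν') ^ 2) / 4)) := by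
  rw [eta, filterHat, filterHat]
  push_cast
  rw [show ∀ a b c k : ℂ, a * ((k * b) * (k * c)) = k ^ 2 * (a * (b * c)) by intros; ring,
    ← Complex.exp_add, ← Complex.exp_add]
  ring_nf

theorem integrable_eta_mul_filterHat_mul {β : ℝ} (hβ : 0 < β) (ν ν' : ℝ) : Integrable fun ω : ℝ =>
    (eta β ω * (filterHat β (ω - ν) * filterHat β (ω - ν')) : ℂ) := by
  simp_rw [eta_mul_filterHat_mul]
  exact (integrable_cexp_real_quadratic (by positivity) _ _).const_mul _

theorem integral_eta_mul_filterHat_mul {β : ℝ} (hβ : 0 < β) (ν ν' : ℝ) :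
    ∫ ω : ℝ, (eta β ω * (filterHat β (ω - ν) * filterHat β (ω - ν')) : ℂ) =
      kossakowski β ν ν' := by
  simp_rw [eta_mul_filterHat_mul]
  have hb : (β : ℂ) ≠ 0 := by exact_mod_cast hβ.ne'
  have hp := Real.pi_pos
  rw [integral_const_mul, integral_cexp_real_quadratic (by positivity), filterConst_sq hβ,
    kossakowski, Real.sqrt_div hp.le, Real.sqrt_sq hβ.le, Real.sqrt_mul zero_le_two,
    show (-1 / 2 - ((β * ν) ^ 2 + (β * ν') ^ 2) / 4 +
      (β * (β * ν + β * ν') / 2 - β) ^ 2 / (4 * (β ^ 2 : ℝ)) : ℂ) =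
      (-(β * ν + β * ν' + 2) ^ 2 / 16 - (β * ν - β * ν') ^ 2 / 8 : ℝ) by
      push_cast; field_simp; ring, ← Complex.ofReal_exp, ← Complex.ofReal_mul,
    ← Complex.ofReal_mul]
  congr 1
  have h3 : 0 < Real.sqrt Real.pi := by positivity
  field_simp

end ThirdQuantization

end

section

open Complex

namespace ThirdQuantization

variable {E : Type*} [NormedAddCommGroup E] [InnerProductSpace ℂ E] [FiniteDimensional ℂ E]
  [CompleteSpace E]

/-! ### The trace form -/

theorem tr_sum {κ : Type*} (s : Finset κ) (F : κ → E →L[ℂ] E) :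
    tr (∑ i ∈ s, F i) = ∑ i ∈ s, tr (F i) := by
  simp [tr]

theorem tr_star (X : E →L[ℂ] E) : tr (star X) = starRingEnd ℂ (tr X) := by
  rw [tr, tr, LinearMap.trace_eq_sum_inner _ (stdOrthonormalBasis ℂ E),
    LinearMap.trace_eq_sum_inner _ (stdOrthonormalBasis ℂ E), map_sum]
  refine Finset.sum_congr rfl fun i _ => ?_
  change inner ℂ _ (star X (stdOrthonormalBasis ℂ E i)) = _
  rw [ContinuousLinearMap.star_eq_adjoint, ContinuousLinearMap.adjoint_inner_right,
    inner_conj_symm]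
  rfl

theorem tr_star_mul_self (X : E →L[ℂ] E) :
    tr (star X * X) = (∑ i, ‖X (stdOrthonormalBasis ℂ E i)‖ ^ 2 : ℝ) := by
  rw [tr, LinearMap.trace_eq_sum_inner _ (stdOrthonormalBasis ℂ E)]
  push_cast
  refine Finset.sum_congr rfl fun i _ => ?_
  change inner ℂ _ (star X (X (stdOrthonormalBasis ℂ E i))) = _
  rw [ContinuousLinearMap.star_eq_adjoint, ContinuousLinearMap.adjoint_inner_right,
    inner_self_eq_norm_sq_to_K]
  rfl

theorem tr_star_mul_self_nonneg (X : E →L[ℂ] E) : 0 ≤ (tr (star X * X)).re := by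
  rw [tr_star_mul_self, ofReal_re]
  positivity

theorem tr_star_mul_self_re (X : E →L[ℂ] E) : ((tr (star X * X)).re : ℂ) = tr (star X * X) := by
  rw [tr_star_mul_self, ofReal_re]

theorem eq_zero_of_tr_star_mul_self {X : E →L[ℂ] E} (h : tr (star X * X) = 0) : X = 0 := by
  rw [tr_star_mul_self, ofReal_eq_zero, Finset.sum_eq_zero_iff_of_nonneg fun i _ => by positivity]
    at h
  apply ContinuousLinearMap.coe_injective
  refine (stdOrthonormalBasis ℂ E).toBasis.ext fun i => ?_
  simpa using h i (Finset.mem_univ i)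

theorem tr_star_mul_self_pos {X : E →L[ℂ] E} (hX : X ≠ 0) : 0 < (tr (star X * X)).re := by
  refine (tr_star_mul_self_nonneg X).lt_of_ne fun h => hX (eq_zero_of_tr_star_mul_self ?_)
  rw [← tr_star_mul_self_re, ← h, ofReal_zero]

/-- The trace form is definite, so the adjoint relation determines the adjoint; no matrix units are
needed afterwards. -/
theorem hsAdjoint_eq_of_tr {T S : (E →L[ℂ] E) →L[ℂ] (E →L[ℂ] E)}
    (h : ∀ X Y, tr (star (T X) * Y) = tr (star X * S Y)) : hsAdjoint T = S := by
  ext1 Y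
  rw [← sub_eq_zero]
  apply eq_zero_of_tr_star_mul_self
  set Z := hsAdjoint T Y - S Y with hZ
  have h1 : tr (star Z * (hsAdjoint T Y)) - tr (star Z * S Y) = 0 := by
    rw [← tr_star_mul_hsAdjoint, h, sub_self]
  rw [hZ, mul_sub, sub_eq_add_neg, ← neg_one_smul ℂ (_ * S Y), tr_add, tr_smul]
  linear_combination h1

/-! ### Spectral resolutions -/

/-- `H = ∑ ε i • Q i` with mutually orthogonal self-adjoint projections `Q i` that sum to `1` and
commute with the commutant of `H`. -/
structure SpectralResolution {ι : Type*} [Fintype ι] [DecidableEq ι] (H : E →L[ℂ] E)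
    (Q : ι → E →L[ℂ] E) (ε : ι → ℝ) : Prop where
  star_eq : ∀ i, star (Q i) = Q i
  mul_eq : ∀ i j, Q i * Q j = if i = j then Q i else 0
  sum_eq : ∑ i, Q i = 1
  left_eq : ∀ i, H * Q i = (ε i : ℂ) • Q i
  commute : ∀ X, Commute H X → ∀ i, Commute (Q i) X

theorem finite_spectrum_real (H : E →L[ℂ] E) : (spectrum ℝ H).Finite := by
  have h1 : (spectrum ℂ H).Finite :=
    (Module.End.finite_spectrum (H : E →ₗ[ℂ] E)).subset
      (AlgHom.spectrum_apply_subset (Module.End.toContinuousLinearMap E).toAlgHom (H : E →ₗ[ℂ] E))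
  exact (h1.preimage (algebraMap ℝ ℂ).injective.injOn).subset fun r hr =>
    (spectrum.algebraMap_mem_iff ℂ).2 hr

/-- The index set is the spectrum itself and each projection is the functional calculus of the
indicator of one point. Finiteness of the spectrum makes every function continuous on it. -/
theorem exists_spectralResolution {H : E →L[ℂ] E} (hH : IsSelfAdjoint H) :
    ∃ (s : Finset ℝ) (Q : s → E →L[ℂ] E), SpectralResolution H Q fun i => (i : ℝ) := by
  have hfin := finite_spectrum_real H
  have hc : ∀ f : ℝ → ℝ, ContinuousOn f (spectrum ℝ H) := fun f => hfin.continuousOn f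
  refine ⟨hfin.toFinset, fun i => cfc (fun x : ℝ => if x = i then (1 : ℝ) else 0) H,
    fun i => (cfc_predicate _ H : IsSelfAdjoint _).star_eq, fun i j => ?_, ?_, fun i => ?_,
    fun X hX i => hX.cfc_real _⟩
  · rw [← cfc_mul _ _ H (hc _) (hc _)]
    split_ifs with h
    · subst h
      congr 1
      ext x
      split_ifs <;> simp
    · rw [← cfc_zero ℝ H]
      congr 1
      ext x
      have : (i : ℝ) ≠ j := fun e => h (Subtype.ext e)
      simp only [Pi.zero_apply]
      split_ifs with h1 h2
      · exact absurd (h1.symm.trans h2) this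
      all_goals simp
  · rw [← cfc_sum_univ _ H fun i => hc _, ← cfc_const_one ℝ H]
    refine cfc_congr fun x hx => ?_
    rw [Finset.sum_apply, Finset.sum_eq_single (⟨x, hfin.mem_toFinset.2 hx⟩ : hfin.toFinset)]
    · simp
    · rintro ⟨y, hy⟩ - hne
      exact if_neg fun e => hne (Subtype.ext e.symm)
    · simp
  · rw [Complex.coe_smul, ← cfc_const_mul _ _ H (hc _)]
    conv_lhs => enter [1]; rw [← cfc_id' ℝ H]
    rw [← cfc_mul _ _ H (hc _) (hc _)]
    congr 1
    ext x
    split_ifs with h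
    · simp [h]
    · simp

namespace SpectralResolution

variable {ι : Type*} [Fintype ι] [DecidableEq ι] {H : E →L[ℂ] E} {Q : ι → E →L[ℂ] E} {ε : ι → ℝ}

/-- On the range of `Q i` every power of `c • H` acts as a scalar, so the exponential series is
summed in ℂ. -/
theorem exp_mul (h : SpectralResolution H Q ε) (c : ℂ) (i : ι) :
    NormedSpace.exp (c • H) * Q i = cexp (c * ε i) • Q i := by
  have hpow : ∀ k : ℕ, (c • H) ^ k * Q i = (c * ε i) ^ k • Q i := by
    intro k
    induction k with
    | zero => simp
    | succ k ih =>
      rw [pow_succ, mul_assoc, smul_mul_assoc, h.left_eq, smul_smul, mul_smul_comm, ih, smul_smul,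
        pow_succ, mul_comm]
  have h1 := (NormedSpace.exp_series_hasSum_exp' (𝕂 := ℂ) (c • H)).mul_right (Q i)
  have h2 := (NormedSpace.exp_series_hasSum_exp' (𝕂 := ℂ) (c * ε i)).smul_const (Q i)
  rw [← Complex.exp_eq_exp_ℂ] at h2
  simp only [smul_mul_assoc, hpow] at h1
  simp only [smul_assoc] at h2
  exact h1.unique h2

theorem mul_exp (h : SpectralResolution H Q ε) (c : ℂ) (i : ι) :
    Q i * NormedSpace.exp (c • H) = cexp (c * ε i) • Q i := by
  rw [← h.exp_mul]
  exact h.commute _ (((Commute.refl H).smul_right c).exp_right) i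

end SpectralResolution

/-- The component `Q i * A * Q j` of `A`. -/
def component {ι : Type*} (Q : ι → E →L[ℂ] E) (A : E →L[ℂ] E) (p : ι × ι) : E →L[ℂ] E :=
  Q p.1 * A * Q p.2

/-- The Bohr frequency of a component. -/
def bohrFreq {ι : Type*} (ε : ι → ℝ) (p : ι × ι) : ℝ := ε p.1 - ε p.2

theorem bohrFreq_swap {ι : Type*} (ε : ι → ℝ) (p : ι × ι) :
    bohrFreq ε p.swap = -bohrFreq ε p := by
  simp [bohrFreq]

/-! ### Bohr components: the integrals become finite sums. -/

namespace SpectralResolution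

variable {ι : Type*} [Fintype ι] [DecidableEq ι] {H : E →L[ℂ] E} {Q : ι → E →L[ℂ] E} {ε : ι → ℝ}

theorem sum_component (h : SpectralResolution H Q ε) (A : E →L[ℂ] E) :
    ∑ p, component Q A p = A := by
  simp only [component, Fintype.sum_prod_type, ← Finset.mul_sum, h.sum_eq, mul_one,
    ← Finset.sum_mul, one_mul]

theorem star_component (h : SpectralResolution H Q ε) {A : E →L[ℂ] E} (hA : IsSelfAdjoint A)
    (p : ι × ι) : star (component Q A p) = component Q A p.swap := by
  simp [component, h.star_eq, hA.star_eq, mul_assoc]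

theorem exp_mul_component (h : SpectralResolution H Q ε) (A : E →L[ℂ] E) (c : ℂ) (p : ι × ι) :
    NormedSpace.exp (c • H) * component Q A p =
      cexp (c * bohrFreq ε p) • (component Q A p * NormedSpace.exp (c • H)) := by
  rw [component, mul_assoc _ _ (NormedSpace.exp _), h.mul_exp, ← mul_assoc, ← mul_assoc,
    h.exp_mul, mul_smul_comm, smul_mul_assoc, smul_mul_assoc, smul_smul, ← Complex.exp_add,
    bohrFreq]
  push_cast
  ring_nf

theorem heisenberg_eq (h : SpectralResolution H Q ε) (A : E →L[ℂ] E) (t : ℝ) :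
    heisenberg H A t = ∑ p, cexp (I * bohrFreq ε p * t) • component Q A p := by
  rw [heisenberg]
  conv_lhs => rw [← h.sum_component A]
  rw [Finset.mul_sum, Finset.sum_mul]
  refine Finset.sum_congr rfl fun p _ => ?_
  rw [component, mul_assoc, mul_assoc (Q p.1 * A), h.mul_exp, ← mul_assoc, ← mul_assoc,
    h.exp_mul, mul_smul_comm, smul_mul_assoc, smul_mul_assoc, smul_smul, ← Complex.exp_add,
    bohrFreq]
  push_cast
  ring_nf

/-- The phase e^{iνt} of a component shifts the Fourier variable of the filter from ω to ω - ν. -/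
theorem jump_eq (h : SpectralResolution H Q ε) {β : ℝ} (hβ : 0 < β) (A : E →L[ℂ] E) (ω : ℝ) :
    jump β H A ω = ∑ p, (filterHat β (ω - bohrFreq ε p) : ℂ) • component Q A p := by
  have e : ∀ t : ℝ, (cexp (-(I * ω * t)) * (filterFn β t : ℂ)) • heisenberg H A t =
      ∑ p, (cexp (-(I * (ω - bohrFreq ε p : ℝ) * t)) * (filterFn β t : ℂ)) • component Q A p := by
    intro t
    rw [h.heisenberg_eq, Finset.smul_sum]
    refine Finset.sum_congr rfl fun p _ => ?_
    rw [smul_smul, mul_right_comm, ← Complex.exp_add]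
    push_cast
    ring_nf
  rw [jump]
  simp_rw [e]
  rw [integral_finsetSum _ fun p _ => (integrable_cexp_mul_filterFn hβ _).smul_const _,
    Finset.smul_sum]
  refine Finset.sum_congr rfl fun p _ => ?_
  rw [integral_smul_const, smul_smul, integral_cexp_mul_filterFn hβ]

end SpectralResolution

/-- The coefficients of the coherent term, up to a factor `I`. -/
noncomputable def coherentCoeff (β ν ν' : ℝ) : ℝ :=
  -(1 / 2) * Real.tanh (β * (ν - ν') / 4) * kossakowski β ν ν'

/-- The Gaussian of b₁ in ν - ν' and that of b₂ in ν + ν' recombine into the exponent of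
`kossakowski`; only the tanh is left over. -/
theorem integral_b₁_mul_integral_b₂ (β ν ν' : ℝ) :
    (∫ t : ℝ, cexp (I * (β * (ν - ν') : ℝ) * t) * b₁ t) *
      (∫ t : ℝ, cexp (-(I * (β * (ν + ν') : ℝ) * t)) * b₂ t) = I * coherentCoeff β ν ν' := by
  rw [integral_cexp_mul_b₁, integral_cexp_mul_b₂, coherentCoeff, kossakowski, neg_mul, neg_mul,
    mul_assoc, ← ofReal_mul, ← mul_neg, ← ofReal_neg]
  congr 2
  rw [show -(β * ν + β * ν' + 2) ^ 2 / 16 - (β * ν - β * ν') ^ 2 / 8 =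
    -(β * (ν - ν')) ^ 2 / 8 + -(β * (ν + ν') + 2) ^ 2 / 16 by ring, Real.exp_add]
  have h2 : Real.sqrt 2 * Real.sqrt 2 = 2 := Real.mul_self_sqrt zero_le_two
  have h3 : 0 < Real.sqrt 2 := by positivity
  have hp := Real.pi_pos
  field_simp
  linear_combination (-2 * Real.tanh (β * (ν - ν') / 4)) * h2

namespace SpectralResolution

variable {ι : Type*} [Fintype ι] [DecidableEq ι] {H : E →L[ℂ] E} {Q : ι → E →L[ℂ] E} {ε : ι → ℝ}

/-- For a pair of components the phase -βν(t' - t) - βν'(t + t') equals β(ν - ν')t - β(ν + ν')t', so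
the double integral splits into a transform of b₁ times one of b₂. -/
theorem coherent_eq (h : SpectralResolution H Q ε) (β : ℝ) (A : E →L[ℂ] E) :
    coherent β H A = ∑ p, ∑ q, (I * coherentCoeff β (bohrFreq ε p) (bohrFreq ε q)) •
      (star (component Q A p) * component Q A q) := by
  have e : ∀ t t' : ℝ, b₂ t' •
      (star (heisenberg H A (β * (t' - t))) * heisenberg H A (-β * (t + t'))) =
      ∑ p : (ι × ι) × (ι × ι),
        (cexp (-(I * (β * (bohrFreq ε p.1 + bohrFreq ε p.2) : ℝ) * t')) * b₂ t') •
        cexp (I * (β * (bohrFreq ε p.1 - bohrFreq ε p.2) : ℝ) * t) •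
          (star (component Q A p.1) * component Q A p.2) := by
    intro t t'
    rw [h.heisenberg_eq, h.heisenberg_eq, star_sum, Finset.sum_mul_sum, Finset.smul_sum,
      Fintype.sum_prod_type (α₁ := ι × ι) (α₂ := ι × ι)]
    refine Finset.sum_congr rfl fun p _ => ?_
    rw [Finset.smul_sum]
    refine Finset.sum_congr rfl fun q _ => ?_
    rw [star_smul, smul_mul_smul_comm, smul_smul, smul_smul, ← starRingEnd_apply, ← exp_conj,
      ← Complex.exp_add, mul_comm, mul_right_comm _ (b₂ t'), ← Complex.exp_add]
    simp only [map_mul, conj_I, conj_ofReal]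
    push_cast
    ring_nf
  rw [coherent]
  simp_rw [e]
  have e2 : ∀ t : ℝ, (b₁ t : ℂ) • ∫ t' : ℝ, ∑ p : (ι × ι) × (ι × ι),
      (cexp (-(I * (β * (bohrFreq ε p.1 + bohrFreq ε p.2) : ℝ) * t')) * b₂ t') •
        cexp (I * (β * (bohrFreq ε p.1 - bohrFreq ε p.2) : ℝ) * t) •
          (star (component Q A p.1) * component Q A p.2) =
      ∑ p : (ι × ι) × (ι × ι),
        (cexp (I * (β * (bohrFreq ε p.1 - bohrFreq ε p.2) : ℝ) * t) * b₁ t) •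
        (∫ t' : ℝ, cexp (-(I * (β * (bohrFreq ε p.1 + bohrFreq ε p.2) : ℝ) * t')) * b₂ t') •
          (star (component Q A p.1) * component Q A p.2) := by
    intro t
    rw [integral_finsetSum _ fun p _ => (integrable_cexp_mul_b₂ _).smul_const _, Finset.smul_sum]
    refine Finset.sum_congr rfl fun p _ => ?_
    rw [integral_smul_const, smul_smul, smul_smul, smul_smul]
    congr 1
    ring
  simp_rw [e2]
  rw [integral_finsetSum _ fun p _ => (integrable_cexp_mul_b₁ _).smul_const _,
    Fintype.sum_prod_type]
  refine Finset.sum_congr rfl fun p _ => Finset.sum_congr rfl fun q _ => ?_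
  rw [integral_smul_const, smul_smul, integral_b₁_mul_integral_b₂]

/-- The dissipator is sesquilinear in the jump operator and the filter transforms are real, so each
pair of components is weighted by one scalar integral over ω. -/
theorem integral_dissipator_jump_apply (h : SpectralResolution H Q ε) {β : ℝ} (hβ : 0 < β)
    (A ρ : E →L[ℂ] E) :
    (∫ ω : ℝ, (eta β ω : ℂ) • dissipator (jump β H A ω)) ρ =
      ∑ p, ∑ q, (kossakowski β (bohrFreq ε p) (bohrFreq ε q) : ℂ) •
        (component Q A p * ρ * star (component Q A q) - (1 / 2 : ℂ) •
          (star (component Q A q) * component Q A p * ρ +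
            ρ * (star (component Q A q) * component Q A p))) := by
  have e : ∀ ω : ℝ, (eta β ω : ℂ) • dissipator (jump β H A ω) = ∑ p : (ι × ι) × (ι × ι),
      (eta β ω * (filterHat β (ω - bohrFreq ε p.1) * filterHat β (ω - bohrFreq ε p.2)) : ℂ) •
        (leftMul (component Q A p.1) * rightMul (star (component Q A p.2)) - (1 / 2 : ℂ) •
          (leftMul (star (component Q A p.2) * component Q A p.1) +
            rightMul (star (component Q A p.2) * component Q A p.1))) := by
    intro ω
    ext1 X
    set r : ι × ι → ℝ := fun p => filterHat β (ω - bohrFreq ε p) with hr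
    have hA : jump β H A ω = ∑ p, (r p : ℂ) • component Q A p := h.jump_eq hβ A ω
    have hs : ∀ p, star (r p : ℂ) = r p := fun p => conj_ofReal _
    have h1 : jump β H A ω * X * star (jump β H A ω) = ∑ p, ∑ q, ((r p : ℂ) * r q) •
        (component Q A p * X * star (component Q A q)) := by
      simp only [hA, star_sum, star_smul, hs, Finset.sum_mul, Finset.mul_sum, smul_mul_assoc,
        mul_smul_comm, Finset.smul_sum, smul_smul]
      rw [Finset.sum_comm]
      simp only [mul_comm]
    have h2 : star (jump β H A ω) * jump β H A ω = ∑ p, ∑ q, ((r p : ℂ) * r q) •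
        (star (component Q A q) * component Q A p) := by
      simp only [hA, star_sum, star_smul, hs, Finset.sum_mul, Finset.mul_sum, smul_mul_assoc,
        mul_smul_comm, Finset.smul_sum, smul_smul]
    have h3 : (∑ p : (ι × ι) × (ι × ι), ((eta β ω : ℂ) * ((r p.1 : ℂ) * r p.2)) •
        (leftMul (component Q A p.1) * rightMul (star (component Q A p.2)) - (1 / 2 : ℂ) •
          (leftMul (star (component Q A p.2) * component Q A p.1) +
            rightMul (star (component Q A p.2) * component Q A p.1)))) X =
        ∑ p, ∑ q, ((eta β ω : ℂ) * ((r p : ℂ) * r q)) •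
          (component Q A p * (X * star (component Q A q)) - (1 / 2 : ℂ) •
            (star (component Q A q) * component Q A p * X +
              X * (star (component Q A q) * component Q A p))) := by
      rw [Fintype.sum_prod_type]
      simp only [sum_apply, smul_apply]
      rfl
    rw [h3]
    change (eta β ω : ℂ) • (jump β H A ω * (X * star (jump β H A ω)) - (1 / 2 : ℂ) •
      (star (jump β H A ω) * jump β H A ω * X + X * (star (jump β H A ω) * jump β H A ω))) = _
    rw [← mul_assoc, h1, h2]
    simp only [Finset.sum_mul, Finset.mul_sum, Finset.smul_sum, ← Finset.sum_add_distrib,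
      ← Finset.sum_sub_distrib]
    refine Finset.sum_congr rfl fun p _ => Finset.sum_congr rfl fun q _ => ?_
    simp only [smul_mul_assoc, mul_smul_comm, mul_assoc]
    module
  simp_rw [e]
  rw [integral_finsetSum _ fun p _ => (integrable_eta_mul_filterHat_mul hβ _ _).smul_const _,
    Fintype.sum_prod_type]
  simp only [integral_smul_const, integral_eta_mul_filterHat_mul hβ,
    sum_apply, smul_apply]
  rfl

end SpectralResolution

end ThirdQuantization

end

section

open Complex

namespace ThirdQuantization

variable {E : Type*} [NormedAddCommGroup E] [InnerProductSpace ℂ E] [FiniteDimensional ℂ E]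
  [CompleteSpace E]

/-! ### The adjoint of the Lindbladian -/

/-- Cyclicity of the trace: the adjoint transposes the real coefficient matrices and turns the jump
shape D X D† into D† Y D. Only the jump shape changes; left and right drift terms keep their sides.
-/
theorem tr_star_mul_of_quadratic {κ : Type*} [Fintype κ] (D : κ → E →L[ℂ] E) (a b c : κ → κ → ℝ)
    (X Y : E →L[ℂ] E) :
    tr (star (∑ p, ∑ q, ((a p q : ℂ) • (D q * X * star (D p)) +
      (b p q : ℂ) • (star (D p) * D q * X) + (c p q : ℂ) • (X * (star (D p) * D q)))) * Y) =
    tr (star X * ∑ p, ∑ q, ((a q p : ℂ) • (star (D p) * Y * D q) +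
      (b q p : ℂ) • (star (D p) * D q * Y) + (c q p : ℂ) • (Y * (star (D p) * D q)))) := by
  simp only [star_sum, Finset.sum_mul, Finset.mul_sum, tr_sum]
  rw [Finset.sum_comm]
  refine Finset.sum_congr rfl fun p _ => Finset.sum_congr rfl fun q _ => ?_
  have hs : ∀ r : ℝ, star (r : ℂ) = r := conj_ofReal
  simp only [star_add, star_smul, hs, star_mul, star_star, add_mul, mul_add, tr_add,
    smul_mul_assoc, mul_smul_comm, tr_smul]
  have h1 : tr (D q * (star X * star (D p)) * Y) = tr (star X * (star (D p) * Y * D q)) := by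
    rw [mul_assoc (D q), tr_mul_comm (D q)]
    simp only [mul_assoc]
  have h2 : tr (star (D p) * D q * star X * Y) = tr (star X * (Y * (star (D p) * D q))) := by
    rw [mul_assoc (star (D p) * D q), tr_mul_comm (star (D p) * D q)]
    simp only [mul_assoc]
  rw [h1, h2, mul_assoc (star X)]

/-- The coefficients of the drift term of the Lindbladian. -/
noncomputable def driftCoeff (β ν ν' : ℝ) : ℝ :=
  -(1 / 2) * kossakowski β ν ν' * (1 + Real.tanh (β * (ν - ν') / 4))

theorem kossakowski_comm (β ν ν' : ℝ) : kossakowski β ν ν' = kossakowski β ν' ν := by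
  rw [kossakowski, kossakowski]
  ring_nf

theorem kossakowski_pos (β ν ν' : ℝ) : 0 < kossakowski β ν ν' := by
  rw [kossakowski]
  positivity

/-- The tanh is odd, so the coherent contributions cancel; this is what makes the adjoint
Lindbladian kill the identity. -/
theorem driftCoeff_add_swap (β ν ν' : ℝ) :
    driftCoeff β ν ν' + driftCoeff β ν' ν = -kossakowski β ν ν' := by
  rw [driftCoeff, driftCoeff, kossakowski_comm β ν' ν,
    show β * (ν' - ν) / 4 = -(β * (ν - ν') / 4) by ring, Real.tanh_neg]
  ring

namespace SpectralResolution

variable {ι : Type*} [Fintype ι] [DecidableEq ι] {H : E →L[ℂ] E} {Q : ι → E →L[ℂ] E} {ε : ι → ℝ}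

/-- The factor -i of the commutator cancels the i of the coherent coefficients. The commutator then
adds to the left half of the anticommutator and subtracts from the right half, giving -α(1 ±
tanh)/2. -/
theorem lindbladian_apply (h : SpectralResolution H Q ε) {β : ℝ} (hβ : 0 < β) {m : ℕ}
    (γ : Fin m → E →L[ℂ] E) (ρ : E →L[ℂ] E) :
    lindbladian β H γ ρ = ∑ j, ∑ p, ∑ q,
      ((kossakowski β (bohrFreq ε p) (bohrFreq ε q) : ℂ) •
          (component Q (γ j) q * ρ * star (component Q (γ j) p)) +
        (driftCoeff β (bohrFreq ε p) (bohrFreq ε q) : ℂ) •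
          (star (component Q (γ j) p) * component Q (γ j) q * ρ) +
        (driftCoeff β (bohrFreq ε q) (bohrFreq ε p) : ℂ) •
          (ρ * (star (component Q (γ j) p) * component Q (γ j) q))) := by
  have h1 : lindbladian β H γ ρ = (-I) • ((∑ j, coherent β H (γ j)) * ρ -
      ρ * ∑ j, coherent β H (γ j)) +
      ∑ j, (∫ ω : ℝ, (eta β ω : ℂ) • dissipator (jump β H (γ j) ω)) ρ := by
    rw [lindbladian, add_apply, sum_apply]
    rfl
  rw [h1, Finset.sum_mul, Finset.mul_sum, ← Finset.sum_sub_distrib, Finset.smul_sum,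
    ← Finset.sum_add_distrib]
  refine Finset.sum_congr rfl fun j _ => ?_
  rw [h.integral_dissipator_jump_apply hβ, h.coherent_eq, Finset.sum_comm (s := Finset.univ)
    (f := fun p q => (kossakowski β (bohrFreq ε p) (bohrFreq ε q) : ℂ) • _)]
  simp only [Finset.sum_mul, Finset.mul_sum, ← Finset.sum_sub_distrib, Finset.smul_sum,
    ← Finset.sum_add_distrib]
  refine Finset.sum_congr rfl fun p _ => Finset.sum_congr rfl fun q _ => ?_
  rw [kossakowski_comm β (bohrFreq ε q), driftCoeff, driftCoeff, coherentCoeff,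
    kossakowski_comm β (bohrFreq ε q),
    show β * (bohrFreq ε q - bohrFreq ε p) / 4 = -(β * (bohrFreq ε p - bohrFreq ε q) / 4) by ring,
    Real.tanh_neg, smul_mul_assoc, mul_smul_comm, ← smul_sub, smul_smul, ← mul_assoc (-I), neg_mul,
    I_mul_I, neg_neg, one_mul]
  push_cast
  module

theorem hsAdjoint_lindbladian_apply (h : SpectralResolution H Q ε) {β : ℝ} (hβ : 0 < β) {m : ℕ}
    (γ : Fin m → E →L[ℂ] E) (X : E →L[ℂ] E) :
    hsAdjoint (lindbladian β H γ) X = ∑ j, ∑ p, ∑ q,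
      ((kossakowski β (bohrFreq ε p) (bohrFreq ε q) : ℂ) •
          (star (component Q (γ j) p) * X * component Q (γ j) q) +
        (driftCoeff β (bohrFreq ε q) (bohrFreq ε p) : ℂ) •
          (star (component Q (γ j) p) * component Q (γ j) q * X) +
        (driftCoeff β (bohrFreq ε p) (bohrFreq ε q) : ℂ) •
          (X * (star (component Q (γ j) p) * component Q (γ j) q))) := by
  set S : (E →L[ℂ] E) →L[ℂ] (E →L[ℂ] E) := ∑ j, ∑ p, ∑ q,
      ((kossakowski β (bohrFreq ε p) (bohrFreq ε q) : ℂ) •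
          (leftMul (star (component Q (γ j) p)) * rightMul (component Q (γ j) q)) +
        (driftCoeff β (bohrFreq ε q) (bohrFreq ε p) : ℂ) •
          leftMul (star (component Q (γ j) p) * component Q (γ j) q) +
        (driftCoeff β (bohrFreq ε p) (bohrFreq ε q) : ℂ) •
          rightMul (star (component Q (γ j) p) * component Q (γ j) q)) with hS
  have hSX : ∀ X, S X = ∑ j, ∑ p, ∑ q,
      ((kossakowski β (bohrFreq ε p) (bohrFreq ε q) : ℂ) •
          (star (component Q (γ j) p) * X * component Q (γ j) q) +
        (driftCoeff β (bohrFreq ε q) (bohrFreq ε p) : ℂ) •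
          (star (component Q (γ j) p) * component Q (γ j) q * X) +
        (driftCoeff β (bohrFreq ε p) (bohrFreq ε q) : ℂ) •
          (X * (star (component Q (γ j) p) * component Q (γ j) q))) := by
    intro X
    simp only [hS, sum_apply, add_apply, smul_apply]
    simp only [mul_assoc]
    rfl
  have hT : hsAdjoint (lindbladian β H γ) = S := by
    refine hsAdjoint_eq_of_tr fun X Y => ?_
    rw [h.lindbladian_apply hβ, hSX, star_sum, Finset.sum_mul, Finset.mul_sum, tr_sum, tr_sum]
    refine Finset.sum_congr rfl fun j _ => ?_
    rw [tr_star_mul_of_quadratic (component Q (γ j))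
      (fun p q => kossakowski β (bohrFreq ε p) (bohrFreq ε q))
      (fun p q => driftCoeff β (bohrFreq ε p) (bohrFreq ε q))
      (fun p q => driftCoeff β (bohrFreq ε q) (bohrFreq ε p))]
    simp only [fun p q => kossakowski_comm β (bohrFreq ε q) (bohrFreq ε p)]
  rw [hT, hSX]

theorem hsAdjoint_lindbladian_one (h : SpectralResolution H Q ε) {β : ℝ} (hβ : 0 < β) {m : ℕ}
    (γ : Fin m → E →L[ℂ] E) : hsAdjoint (lindbladian β H γ) 1 = 0 := by
  rw [h.hsAdjoint_lindbladian_apply hβ]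
  refine Finset.sum_eq_zero fun j _ => Finset.sum_eq_zero fun p _ =>
    Finset.sum_eq_zero fun q _ => ?_
  rw [mul_one, mul_one, one_mul, ← add_smul, ← add_smul, ← ofReal_add, ← ofReal_add, add_assoc,
    add_comm (driftCoeff β _ _), driftCoeff_add_swap, add_neg_cancel, ofReal_zero, zero_smul]

end SpectralResolution

/-! ### Powers of the Gibbs state -/

theorem exp_smul_eq_cfc {H : E →L[ℂ] E} (hH : IsSelfAdjoint H) (r : ℝ) :
    NormedSpace.exp ((r : ℂ) • H) = cfc (fun x : ℝ => Real.exp (r * x)) H := by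
  rw [Complex.coe_smul, ← CFC.real_exp_eq_normedSpace_exp ((IsSelfAdjoint.all r).smul hH),
    cfc_comp_const_mul r Real.exp H]

theorem exp_smul_mul_exp_smul {H : E →L[ℂ] E} (hH : IsSelfAdjoint H) (r s : ℝ) :
    NormedSpace.exp ((r : ℂ) • H) * NormedSpace.exp ((s : ℂ) • H) =
      NormedSpace.exp (((r + s : ℝ) : ℂ) • H) := by
  rw [exp_smul_eq_cfc hH, exp_smul_eq_cfc hH, exp_smul_eq_cfc hH, ← cfc_mul _ _ H]
  simp only [← Real.exp_add, add_mul]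

/-- The constant is the partition function. It is real and positive because e^{-βH} = X†X with X =
e^{-βH/2}, whose trace is a squared Hilbert-Schmidt norm. -/
theorem exists_gibbsPow_eq [Nontrivial E] {H : E →L[ℂ] E} (hH : IsSelfAdjoint H) (β : ℝ) :
    ∃ Z : ℝ, 0 < Z ∧ ∀ s : ℝ, gibbsPow β H s =
      ((Z ^ (-s) : ℝ) : ℂ) • NormedSpace.exp (((-(s * β) : ℝ) : ℂ) • H) := by
  set X := NormedSpace.exp (((-β / 2 : ℝ) : ℂ) • H) with hX
  have hXs : IsSelfAdjoint X := by
    rw [hX, exp_smul_eq_cfc hH]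
    exact cfc_predicate _ H
  have hXX : star X * X = NormedSpace.exp (-(β : ℂ) • H) := by
    rw [hXs.star_eq, hX, exp_smul_mul_exp_smul hH, add_halves, ofReal_neg]
  have hX0 : X ≠ 0 := by
    intro h0
    have h1 := exp_smul_mul_exp_smul hH (-β / 2) (β / 2)
    rw [← hX, h0, zero_mul, neg_div, neg_add_cancel, ofReal_zero, zero_smul,
      NormedSpace.exp_zero] at h1
    exact zero_ne_one h1
  have hZ := tr_star_mul_self_pos hX0
  have hZ' := tr_star_mul_self_re X
  rw [hXX] at hZ hZ'
  refine ⟨_, hZ, fun s => ?_⟩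
  set Z := (tr (NormedSpace.exp (-(β : ℂ) • H))).re
  have h1 : gibbs β H = cfc (fun x : ℝ => Z⁻¹ * Real.exp (-β * x)) H := by
    rw [gibbs, ← hZ', ← ofReal_inv, Complex.coe_smul, ← ofReal_neg, exp_smul_eq_cfc hH,
      cfc_const_mul _ _ H]
  have h2 : gibbsPow β H s = gibbs β H ^ s := rfl
  rw [h2, h1, CFC.cfc_rpow (fun x _ => by positivity), Complex.coe_smul, exp_smul_eq_cfc hH,
    ← cfc_const_mul _ _ H]
  congr 1
  ext x
  rw [Real.mul_rpow (by positivity) (by positivity), Real.inv_rpow hZ.le, Real.rpow_neg hZ.le,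
    ← Real.exp_mul]
  ring_nf

theorem isSelfAdjoint_gibbsPow (β : ℝ) (H : E →L[ℂ] E) (s : ℝ) : IsSelfAdjoint (gibbsPow β H s) :=
  IsSelfAdjoint.of_nonneg (CFC.rpow_nonneg (a := gibbs β H) (y := s))

theorem gibbsPow_mul [Nontrivial E] {H : E →L[ℂ] E} (hH : IsSelfAdjoint H) (β s t : ℝ) :
    gibbsPow β H s * gibbsPow β H t = gibbsPow β H (s + t) := by
  obtain ⟨Z, hZ, h⟩ := exists_gibbsPow_eq hH β
  rw [h, h, h, smul_mul_smul_comm, exp_smul_mul_exp_smul hH, neg_add, Real.rpow_add hZ,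
    ← ofReal_mul]
  ring_nf

theorem gibbsPow_zero [Nontrivial E] {H : E →L[ℂ] E} (hH : IsSelfAdjoint H) (β : ℝ) :
    gibbsPow β H 0 = 1 := by
  obtain ⟨Z, hZ, h⟩ := exists_gibbsPow_eq hH β
  rw [h]
  simp

theorem commute_gibbsPow [Nontrivial E] {H X : E →L[ℂ] E} (hH : IsSelfAdjoint H)
    (hX : Commute H X) (β s : ℝ) : Commute (gibbsPow β H s) X := by
  obtain ⟨Z, hZ, h⟩ := exists_gibbsPow_eq hH β
  rw [h]
  exact ((hX.smul_left _).exp_left).smul_left _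

theorem gibbsConj_apply (β : ℝ) (H : E →L[ℂ] E) (s : ℝ) (X : E →L[ℂ] E) :
    gibbsConj β H s X = gibbsPow β H s * X * gibbsPow β H s := by
  rw [mul_assoc]
  rfl

theorem gibbsConj_gibbsConj [Nontrivial E] {H : E →L[ℂ] E} (hH : IsSelfAdjoint H) (β s t : ℝ)
    (X : E →L[ℂ] E) : gibbsConj β H s (gibbsConj β H t X) = gibbsConj β H (s + t) X := by
  have h1 := gibbsPow_mul hH β s t
  have h2 := gibbsPow_mul hH β t s
  rw [add_comm] at h2
  rw [gibbsConj_apply, gibbsConj_apply, gibbsConj_apply]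
  nth_rw 2 [← h2]
  rw [← h1]
  simp only [mul_assoc]

theorem gibbsConj_zero [Nontrivial E] {H : E →L[ℂ] E} (hH : IsSelfAdjoint H) (β : ℝ)
    (X : E →L[ℂ] E) : gibbsConj β H 0 X = X := by
  rw [gibbsConj_apply, gibbsPow_zero hH, one_mul, mul_one]

/-- Components are eigenvectors of the modular flow; the normalization of the state cancels. -/
theorem SpectralResolution.gibbsPow_mul_component [Nontrivial E] {ι : Type*} [Fintype ι]
    [DecidableEq ι] {H : E →L[ℂ] E} {Q : ι → E →L[ℂ] E} {ε : ι → ℝ}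
    (h : SpectralResolution H Q ε) (hH : IsSelfAdjoint H) (A : E →L[ℂ] E) (β s : ℝ) (p : ι × ι) :
    gibbsPow β H s * component Q A p =
      (Real.exp (-(s * β * bohrFreq ε p)) : ℂ) • (component Q A p * gibbsPow β H s) := by
  obtain ⟨Z, hZ, hG⟩ := exists_gibbsPow_eq hH β
  rw [hG, smul_mul_assoc, h.exp_mul_component, mul_smul_comm, smul_comm]
  push_cast
  ring_nf

/-! ### Detailed balance -/

/-- The coefficients of the jump term of the parent Hamiltonian. -/
noncomputable def parentJumpCoeff (β ν ν' : ℝ) : ℝ :=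
  kossakowski β ν ν' * Real.exp (β * (ν + ν') / 4)

/-- The coefficients of the drift term of the parent Hamiltonian. -/
noncomputable def parentDriftCoeff (β ν ν' : ℝ) : ℝ :=
  -(1 / 2) * kossakowski β ν ν' / Real.cosh (β * (ν - ν') / 4)

theorem parentDriftCoeff_comm (β ν ν' : ℝ) :
    parentDriftCoeff β ν ν' = parentDriftCoeff β ν' ν := by
  rw [parentDriftCoeff, parentDriftCoeff, kossakowski_comm,
    show β * (ν' - ν) / 4 = -(β * (ν - ν') / 4) by ring, Real.cosh_neg]

/-- The identity (1 + tanh δ) e^{-δ} = 1 / cosh δ: the coherent term is designed to make the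
conjugated drift even in δ. -/
theorem driftCoeff_mul_exp (β ν ν' : ℝ) :
    driftCoeff β ν ν' * Real.exp (-(β * (ν - ν') / 4)) = parentDriftCoeff β ν ν' := by
  rw [driftCoeff, parentDriftCoeff, Real.tanh_eq_sinh_div_cosh]
  set δ := β * (ν - ν') / 4
  have h1 := Real.cosh_pos δ
  have h2 : (Real.cosh δ + Real.sinh δ) * Real.exp (-δ) = 1 := by
    rw [Real.cosh_add_sinh, ← Real.exp_add, add_neg_cancel, Real.exp_zero]
  field_simp
  linear_combination -kossakowski β ν ν' * h2

theorem parentJumpCoeff_comm (β ν ν' : ℝ) :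
    parentJumpCoeff β ν ν' = parentJumpCoeff β ν' ν := by
  rw [parentJumpCoeff, parentJumpCoeff, kossakowski_comm, add_comm ν]

/-- Expanding -(βν + βν' + 2)²/16 gives the linear term -β(ν + ν')/4, which the exponential cancels;
the remaining exponent is even. -/
theorem parentJumpCoeff_neg (β ν ν' : ℝ) :
    parentJumpCoeff β (-ν) (-ν') = parentJumpCoeff β ν ν' := by
  rw [parentJumpCoeff, parentJumpCoeff, kossakowski, kossakowski, mul_assoc, mul_assoc,
    ← Real.exp_add, ← Real.exp_add]
  ring_nf

/-- The similarity transform `Γ ∘ ℒ† ∘ Γ⁻¹` of the adjoint Lindbladian. -/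
noncomputable def symmetrized {m : ℕ} (β : ℝ) (H : E →L[ℂ] E) (γ : Fin m → E →L[ℂ] E) :
    (E →L[ℂ] E) →L[ℂ] (E →L[ℂ] E) :=
  gibbsConj β H (1 / 4) * hsAdjoint (lindbladian β H γ) * gibbsConj β H (-(1 / 4))

namespace SpectralResolution

variable {ι : Type*} [Fintype ι] [DecidableEq ι] {H : E →L[ℂ] E} {Q : ι → E →L[ℂ] E} {ε : ι → ℝ}

theorem symmetrized_apply [Nontrivial E] (h : SpectralResolution H Q ε) (hH : IsSelfAdjoint H)
    {β : ℝ} (hβ : 0 < β) {m : ℕ} {γ : Fin m → E →L[ℂ] E} (hγ : ∀ j, IsSelfAdjoint (γ j))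
    (X : E →L[ℂ] E) :
    symmetrized β H γ X = ∑ j, ∑ p, ∑ q,
      ((parentJumpCoeff β (bohrFreq ε p) (bohrFreq ε q) : ℂ) •
          (star (component Q (γ j) p) * X * component Q (γ j) q) +
        (parentDriftCoeff β (bohrFreq ε p) (bohrFreq ε q) : ℂ) •
          (star (component Q (γ j) p) * component Q (γ j) q * X) +
        (parentDriftCoeff β (bohrFreq ε p) (bohrFreq ε q) : ℂ) •
          (X * (star (component Q (γ j) p) * component Q (γ j) q))) := by
  change gibbsConj β H (1 / 4) (hsAdjoint (lindbladian β H γ) (gibbsConj β H (-(1 / 4)) X)) = _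
  rw [gibbsConj_apply, gibbsConj_apply, h.hsAdjoint_lindbladian_apply hβ]
  set u := gibbsPow β H (1 / 4) with hu
  set v := gibbsPow β H (-(1 / 4)) with hv
  have huv : u * v = 1 := by
    rw [hu, hv, gibbsPow_mul hH, add_neg_cancel, gibbsPow_zero hH]
  have hvu : v * u = 1 := by
    rw [hu, hv, gibbsPow_mul hH, neg_add_cancel, gibbsPow_zero hH]
  simp only [Finset.sum_mul, Finset.mul_sum]
  refine Finset.sum_congr rfl fun j _ => Finset.sum_congr rfl fun p _ =>
    Finset.sum_congr rfl fun q _ => ?_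
  set a := bohrFreq ε p with ha
  set b := bohrFreq ε q with hb
  have hus : u * star (component Q (γ j) p) =
      (Real.exp (β * a / 4) : ℂ) • (star (component Q (γ j) p) * u) := by
    rw [h.star_component (hγ j), h.gibbsPow_mul_component hH, bohrFreq_swap,
      show -(1 / 4 * β * -bohrFreq ε p) = β * a / 4 by ring]
  have huc : u * component Q (γ j) q =
      (Real.exp (-(β * b / 4)) : ℂ) • (component Q (γ j) q * u) := by
    rw [h.gibbsPow_mul_component hH, show -(1 / 4 * β * bohrFreq ε q) = -(β * b / 4) by ring]
  have hvs : v * star (component Q (γ j) p) =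
      (Real.exp (-(β * a / 4)) : ℂ) • (star (component Q (γ j) p) * v) := by
    rw [h.star_component (hγ j), h.gibbsPow_mul_component hH, bohrFreq_swap,
      show -(-(1 / 4) * β * -bohrFreq ε p) = -(β * a / 4) by ring]
  have hvc : v * component Q (γ j) q =
      (Real.exp (β * b / 4) : ℂ) • (component Q (γ j) q * v) := by
    rw [h.gibbsPow_mul_component hH, show -(-(1 / 4) * β * bohrFreq ε q) = β * b / 4 by ring]
  generalize component Q (γ j) q = C at *
  generalize component Q (γ j) p = D at *
  have e1 : u * (star D * (v * X * v) * C) * u =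
      (Real.exp (β * a / 4) * Real.exp (β * b / 4) : ℂ) • (star D * X * C) := by
    calc u * (star D * (v * X * v) * C) * u = (u * star D) * v * X * (v * C) * u := by
          simp only [mul_assoc]
      _ = (Real.exp (β * a / 4) * Real.exp (β * b / 4) : ℂ) •
          (star D * (u * v) * X * C * (v * u)) := by
          rw [hus, hvc]
          simp only [smul_mul_assoc, mul_smul_comm, smul_smul, mul_assoc]
          rw [mul_comm (Complex.ofReal _)]
      _ = _ := by rw [huv, hvu, mul_one, mul_one]
  have e2 : u * (star D * C * (v * X * v)) * u =
      (Real.exp (β * a / 4) * Real.exp (-(β * b / 4)) : ℂ) • (star D * C * X) := by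
    calc u * (star D * C * (v * X * v)) * u = (u * star D) * C * v * X * (v * u) := by
          simp only [mul_assoc]
      _ = (Real.exp (β * a / 4) : ℂ) • (star D * (u * C) * v * X * (v * u)) := by
          rw [hus]
          simp only [smul_mul_assoc, mul_assoc]
      _ = (Real.exp (β * a / 4) * Real.exp (-(β * b / 4)) : ℂ) •
          (star D * C * (u * v) * X * (v * u)) := by
          rw [huc]
          simp only [smul_mul_assoc, mul_smul_comm, smul_smul, mul_assoc]
      _ = _ := by rw [huv, hvu, mul_one, mul_one]
  have e3 : u * (v * X * v * (star D * C)) * u =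
      (Real.exp (-(β * a / 4)) * Real.exp (β * b / 4) : ℂ) • (X * (star D * C)) := by
    calc u * (v * X * v * (star D * C)) * u = (u * v) * X * (v * star D) * C * u := by
          simp only [mul_assoc]
      _ = (Real.exp (-(β * a / 4)) : ℂ) • ((u * v) * X * star D * (v * C) * u) := by
          rw [hvs]
          simp only [smul_mul_assoc, mul_smul_comm, mul_assoc]
      _ = (Real.exp (-(β * a / 4)) * Real.exp (β * b / 4) : ℂ) •
          ((u * v) * X * star D * C * (v * u)) := by
          rw [hvc]
          simp only [smul_mul_assoc, mul_smul_comm, smul_smul, mul_assoc]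
      _ = _ := by rw [huv, hvu, mul_one, one_mul, mul_assoc]
  have k1 : kossakowski β a b * (Real.exp (β * a / 4) * Real.exp (β * b / 4)) =
      parentJumpCoeff β a b := by
    rw [parentJumpCoeff, ← Real.exp_add]
    ring_nf
  have k2 : driftCoeff β b a * (Real.exp (β * a / 4) * Real.exp (-(β * b / 4))) =
      parentDriftCoeff β a b := by
    rw [parentDriftCoeff_comm, ← driftCoeff_mul_exp, ← Real.exp_add]
    ring_nf
  have k3 : driftCoeff β a b * (Real.exp (-(β * a / 4)) * Real.exp (β * b / 4)) =
      parentDriftCoeff β a b := by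
    rw [← driftCoeff_mul_exp, ← Real.exp_add]
    ring_nf
  rw [mul_add, mul_add, add_mul, add_mul]
  simp only [mul_smul_comm, smul_mul_assoc, e1, e2, e3, smul_smul]
  simp only [← ofReal_mul, k1, k2, k3]

/-- Since γ_j is self-adjoint, the adjoint of a component is the component with swapped indices and
opposite frequency. Swapping all indices moves the star to the right factor without changing the
coefficients. -/
theorem symmetrized_apply' [Nontrivial E] (h : SpectralResolution H Q ε) (hH : IsSelfAdjoint H)
    {β : ℝ} (hβ : 0 < β) {m : ℕ} {γ : Fin m → E →L[ℂ] E} (hγ : ∀ j, IsSelfAdjoint (γ j))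
    (X : E →L[ℂ] E) :
    symmetrized β H γ X = ∑ j, ∑ p, ∑ q,
      ((parentJumpCoeff β (bohrFreq ε p) (bohrFreq ε q) : ℂ) •
          (component Q (γ j) q * X * star (component Q (γ j) p)) +
        (parentDriftCoeff β (bohrFreq ε p) (bohrFreq ε q) : ℂ) •
          (star (component Q (γ j) p) * component Q (γ j) q * X) +
        (parentDriftCoeff β (bohrFreq ε p) (bohrFreq ε q) : ℂ) •
          (X * (star (component Q (γ j) p) * component Q (γ j) q))) := by
  rw [h.symmetrized_apply hH hβ hγ]
  simp only [Finset.sum_add_distrib]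
  congr 2
  refine Finset.sum_congr rfl fun j _ => ?_
  rw [Finset.sum_comm]
  refine Fintype.sum_equiv (Equiv.prodComm ι ι) _ _ fun q => ?_
  refine Fintype.sum_equiv (Equiv.prodComm ι ι) _ _ fun p => ?_
  rw [Equiv.prodComm_apply, Equiv.prodComm_apply, h.star_component (hγ j), bohrFreq_swap,
    bohrFreq_swap, parentJumpCoeff_neg, parentJumpCoeff_comm, h.star_component (hγ j),
    Prod.swap_swap]

/-- Detailed balance: `Γ ∘ ℒ† ∘ Γ⁻¹` is symmetric for the Hilbert-Schmidt inner product. -/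
theorem tr_star_symmetrized_mul [Nontrivial E] (h : SpectralResolution H Q ε)
    (hH : IsSelfAdjoint H) {β : ℝ} (hβ : 0 < β) {m : ℕ} {γ : Fin m → E →L[ℂ] E}
    (hγ : ∀ j, IsSelfAdjoint (γ j)) (X Y : E →L[ℂ] E) :
    tr (star (symmetrized β H γ X) * Y) = tr (star X * symmetrized β H γ Y) := by
  -- The adjoint of the D X D† form has the D† Y D shape, hence the two different expansions on the
  -- two sides.
  rw [h.symmetrized_apply' hH hβ hγ X, h.symmetrized_apply hH hβ hγ Y, star_sum, Finset.sum_mul,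
    Finset.mul_sum, tr_sum, tr_sum]
  refine Finset.sum_congr rfl fun j _ => ?_
  rw [tr_star_mul_of_quadratic (component Q (γ j))
    (fun p q => parentJumpCoeff β (bohrFreq ε p) (bohrFreq ε q))
    (fun p q => parentDriftCoeff β (bohrFreq ε p) (bohrFreq ε q))
    (fun p q => parentDriftCoeff β (bohrFreq ε p) (bohrFreq ε q))]
  simp only [fun p q => parentJumpCoeff_comm β (bohrFreq ε q) (bohrFreq ε p),
    fun p q => parentDriftCoeff_comm β (bohrFreq ε q) (bohrFreq ε p)]

end SpectralResolution

end ThirdQuantization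

end

section

open Complex

namespace ThirdQuantization

/-! ### Eigenvalues under intertwining maps -/

section Intertwining

variable {K V W : Type*} [Field K] [AddCommGroup V] [Module K V] [AddCommGroup W] [Module K W]

theorem hasEigenvalue_of_intertwining {f : Module.End K W} {g : Module.End K V} {J : V →ₗ[K] W}
    (hJ : Function.Injective J) (h : ∀ x, f (J x) = J (g x)) {μ : K} (hμ : g.HasEigenvalue μ) :
    f.HasEigenvalue μ := by
  obtain ⟨x, hx⟩ := hμ.exists_hasEigenvector
  refine Module.End.hasEigenvalue_of_hasEigenvector (x := J x)
    ⟨Module.End.mem_eigenspace_iff.2 ?_, fun h0 => hx.2 (hJ (h0.trans (map_zero J).symm))⟩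
  rw [h, hx.apply_eq_smul, map_smul]

theorem finrank_eigenspace_le_of_intertwining [FiniteDimensional K W] {f : Module.End K W}
    {g : Module.End K V} {J : V →ₗ[K] W} (hJ : Function.Injective J)
    (h : ∀ x, f (J x) = J (g x)) (μ : K) :
    Module.finrank K (g.eigenspace μ) ≤ Module.finrank K (f.eigenspace μ) := by
  have hmaps : ∀ x ∈ g.eigenspace μ, J x ∈ f.eigenspace μ := fun x hx => by
    rw [Module.End.mem_eigenspace_iff] at hx ⊢
    rw [h, hx, map_smul]
  refine LinearMap.finrank_le_finrank_of_injective (f := J.restrict hmaps) fun x y hxy => ?_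
  exact Subtype.ext (hJ (congrArg Subtype.val hxy))

/-- Otherwise the expansion of the quadratic form in an eigenbasis would have only nonnegative
terms. -/
theorem exists_neg_eigenvalue_of_isSymmetric {V : Type*} [NormedAddCommGroup V]
    [InnerProductSpace ℂ V] [FiniteDimensional ℂ V] {f : V →ₗ[ℂ] V} (hf : f.IsSymmetric) {v : V}
    (hv : (inner ℂ v (f v)).re < 0) : ∃ r : ℝ, r < 0 ∧ Module.End.HasEigenvalue f (r : ℂ) := by
  by_contra! hcon
  have hnn : ∀ i, 0 ≤ hf.eigenvalues rfl i := fun i => by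
    by_contra! hi
    exact hcon _ hi (hf.hasEigenvalue_eigenvalues rfl i)
  refine absurd hv (not_lt.2 ?_)
  rw [← (hf.eigenvectorBasis rfl).sum_inner_mul_inner v (f v), Complex.re_sum]
  refine Finset.sum_nonneg fun i _ => ?_
  have h1 : inner ℂ (hf.eigenvectorBasis rfl i) (f v) =
      (hf.eigenvalues rfl i : ℂ) * inner ℂ (hf.eigenvectorBasis rfl i) v := by
    rw [← hf, hf.apply_eigenvectorBasis, inner_smul_left]
    simp
  rw [h1, mul_left_comm, re_ofReal_mul]
  refine mul_nonneg (hnn i) ?_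
  rw [← RCLike.re_eq_complex_re, inner_mul_symm_re_eq_norm]
  exact norm_nonneg _

/-- The range of `J` is invariant under `f`, and `f` stays symmetric there; an eigenvector found in
the range pulls back along `J`. -/
theorem exists_neg_eigenvalue_of_intertwining {V W : Type*} [AddCommGroup V] [Module ℂ V]
    [NormedAddCommGroup W] [InnerProductSpace ℂ W] [FiniteDimensional ℂ W] {f : W →ₗ[ℂ] W}
    (hf : f.IsSymmetric) {g : Module.End ℂ V} {J : V →ₗ[ℂ] W} (hJ : Function.Injective J)
    (h : ∀ x, f (J x) = J (g x)) {x : V} (hx : (inner ℂ (J x) (J (g x))).re < 0) :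
    ∃ r : ℝ, r < 0 ∧ g.HasEigenvalue (r : ℂ) := by
  have hmaps : ∀ w ∈ LinearMap.range J, f w ∈ LinearMap.range J := by
    rintro _ ⟨y, rfl⟩
    exact ⟨g y, (h y).symm⟩
  obtain ⟨r, hr, hev⟩ := exists_neg_eigenvalue_of_isSymmetric (hf.restrict_invariant hmaps)
    (v := ⟨J x, x, rfl⟩) (by rw [← h] at hx; exact hx)
  obtain ⟨⟨_, y, rfl⟩, hy⟩ := hev.exists_hasEigenvector
  refine ⟨r, hr, Module.End.hasEigenvalue_of_hasEigenvector (x := y)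
    ⟨Module.End.mem_eigenspace_iff.2 (hJ ?_), fun h0 => hy.2 ?_⟩⟩
  · rw [← h, map_smul]
    exact congrArg Subtype.val hy.apply_eq_smul
  · subst h0
    exact Subtype.ext (map_zero J)

theorem exists_isGreatest_negEigenvalues {V : Type*} [AddCommGroup V] [Module ℂ V]
    [FiniteDimensional ℂ V] {f : Module.End ℂ V} (hf : (negEigenvalues f).Nonempty) :
    ∃ r, IsGreatest (negEigenvalues f) r := by
  have hfin : (negEigenvalues f).Finite :=
    (f.finite_hasEigenvalue.preimage ofReal_injective.injOn).subset fun r hr => hr.2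
  obtain ⟨r, hr, hmax⟩ := Set.exists_max_image _ id hfin hf
  exact ⟨r, hr, hmax⟩

end Intertwining

/-! ### Parity -/

variable {E : Type*} [NormedAddCommGroup E] [InnerProductSpace ℂ E] [FiniteDimensional ℂ E]
  [CompleteSpace E]

theorem IsMajorana.parityOp_mul {n : ℕ} {γ : Fin (2 * n) → E →L[ℂ] E} (h : IsMajorana n γ)
    (j : Fin (2 * n)) : parityOp γ * γ j = -(γ j * parityOp γ) := by
  have h1 := h.mul_monomial j (fun _ => 1)
  have h2 : monomial γ (fun _ => 1) = (List.ofFn γ).prod := by simp [monomial]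
  have h3 : (-1 : ℂ) ^ (weight (fun _ : Fin (2 * n) => (1 : Fin 2)) + ((1 : Fin 2) : ℕ)) = -1 := by
    rw [pow_add]; simp [weight]
  rw [h2, h3] at h1
  simp only [parityOp, smul_mul_assoc, mul_smul_comm, h1]
  simp

theorem aParity_aParity (n : ℕ) (v : Enlarged n) : aParity n (aParity n v) = v := by
  ext α
  change (-1 : ℂ) ^ weight α * ((-1 : ℂ) ^ weight α * v α) = v α
  rw [← mul_assoc, ← mul_pow]
  simp

/-- Conjugation by the fermion parity operator. -/
noncomputable def IsMajorana.parityConj {n : ℕ} {γ : Fin (2 * n) → E →L[ℂ] E}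
    (h : IsMajorana n γ) : (E →L[ℂ] E) ≃⋆ₐ[ℂ] (E →L[ℂ] E) :=
  Unitary.conjStarAlgAut ℂ (E →L[ℂ] E) ⟨parityOp γ, h.parityOp_mem_unitary⟩

namespace IsMajorana

variable {n : ℕ} {γ : Fin (2 * n) → E →L[ℂ] E}

theorem parityConj_apply (h : IsMajorana n γ) (X : E →L[ℂ] E) :
    h.parityConj X = parityOp γ * X * star (parityOp γ) := rfl

theorem star_parityOp_mul (h : IsMajorana n γ) : star (parityOp γ) * parityOp γ = 1 :=
  (Unitary.mem_iff.1 h.parityOp_mem_unitary).1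

theorem parityOp_mul_star (h : IsMajorana n γ) : parityOp γ * star (parityOp γ) = 1 :=
  (Unitary.mem_iff.1 h.parityOp_mem_unitary).2

theorem parityConj_majorana (h : IsMajorana n γ) (j : Fin (2 * n)) :
    h.parityConj (γ j) = -γ j := by
  rw [h.parityConj_apply, h.parityOp_mul, neg_mul, mul_assoc, h.parityOp_mul_star, mul_one]

theorem parityConj_eq_self_iff (h : IsMajorana n γ) {X : E →L[ℂ] E} :
    h.parityConj X = X ↔ Commute X (parityOp γ) := by
  rw [h.parityConj_apply]
  constructor
  · intro hX
    have h1 := congrArg (· * parityOp γ) hX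
    simp only [mul_assoc, h.star_parityOp_mul, mul_one] at h1
    exact h1.symm
  · intro hX
    rw [← hX.eq, mul_assoc, h.parityOp_mul_star, mul_one]

/-- Under φ, conjugation by the parity operator becomes the operator (-1)^n̂. -/
theorem parityConj_phiInv (h : IsMajorana n γ) (v : Enlarged n) :
    h.parityConj (phiInv γ v) = phiInv γ (aParity n v) := by
  change h.parityConj (∑ α, v α • monomial γ α) = ∑ α, ((-1 : ℂ) ^ weight α * v α) • monomial γ α
  rw [map_sum]
  refine Finset.sum_congr rfl fun α _ => ?_
  rw [map_smul, h.parityConj_apply, h.monomial_mul_parityOp, smul_mul_assoc, mul_assoc,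
    h.parityOp_mul_star, mul_one, smul_smul,
    mul_comm (v α)]

theorem parityConj_parityConj (h : IsMajorana n γ) (X : E →L[ℂ] E) :
    h.parityConj (h.parityConj X) = X := by
  rw [← phiInv_phi h X, h.parityConj_phiInv, h.parityConj_phiInv, aParity_aParity]

/-- For an invariant operator each odd monomial coefficient equals its own negative. -/
theorem mem_evenOps_iff (h : IsMajorana n γ) {X : E →L[ℂ] E} :
    X ∈ evenOps γ ↔ h.parityConj X = X := by
  refine ⟨h.parityOp_conj_of_even, fun hX => ?_⟩
  have h1 : phi γ X = aParity n (phi γ X) := by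
    rw [← phi_phiInv h (aParity n (phi γ X)), ← h.parityConj_phiInv, phiInv_phi h, hX]
  rw [← phiInv_phi h X]
  refine Submodule.sum_mem _ fun α _ => ?_
  rcases Nat.even_or_odd (weight α) with hα | hα
  · exact Submodule.smul_mem _ _ (Submodule.subset_span ⟨α, hα, rfl⟩)
  · have h2 : phi γ X α = (-1 : ℂ) ^ weight α * phi γ X α := congrArg (fun v : Enlarged n => v α) h1
    rw [hα.neg_one_pow, neg_one_mul, self_eq_neg] at h2
    rw [h2, zero_smul]
    exact Submodule.zero_mem _

theorem tr_parityConj (h : IsMajorana n γ) (X : E →L[ℂ] E) : tr (h.parityConj X) = tr X := by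
  rw [h.parityConj_apply, tr_mul_comm, ← mul_assoc, h.star_parityOp_mul, one_mul]

/-- φ is an isometry up to the factor 2^{-n}, so symmetry on H' can be tested with the trace form.
-/
theorem inner_phi_phi (h : IsMajorana n γ) (X Y : E →L[ℂ] E) :
    inner ℂ (phi γ X) (phi γ Y) = (2 ^ n : ℂ)⁻¹ * tr (star X * Y) := by
  have h1 : tr (star X * Y) = tr (star X * phiInv γ (phi γ Y)) := by rw [phiInv_phi h]
  have h2 : phiInv γ (phi γ Y) = ∑ α, phi γ Y α • monomial γ α := rfl
  rw [h1, h2, Finset.mul_sum, tr_sum, Finset.mul_sum, PiLp.inner_apply]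
  refine Finset.sum_congr rfl fun α _ => ?_
  have h3 : phi γ X α = (2 ^ n : ℂ)⁻¹ * tr (star (monomial γ α) * X) := rfl
  have h4 : tr (star X * monomial γ α) = starRingEnd ℂ (tr (star (monomial γ α) * X)) := by
    rw [← tr_star, star_mul, star_star]
  rw [mul_smul_comm, tr_smul, h4, RCLike.inner_apply, h3, map_mul, map_inv₀, map_pow]
  simp only [map_ofNat]
  ring

theorem phi_injective (h : IsMajorana n γ) : Function.Injective (phi γ) :=
  Function.LeftInverse.injective (phiInv_phi h)

/-! ### The image of a parity-preserving symmetric super-operator under third quantization -/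

theorem Phi_phi (h : IsMajorana n γ) (T : (E →L[ℂ] E) →L[ℂ] (E →L[ℂ] E)) (X : E →L[ℂ] E) :
    Phi γ T (phi γ X) = phi γ ((1 / 2 : ℂ) • (T X + T (X * parityOp γ) * star (parityOp γ) +
      (T (h.parityConj X) - T (parityOp γ * X) * star (parityOp γ)))) := by
  have h1 : phiInv γ (aParity n (phi γ X)) = h.parityConj X := by
    rw [← h.parityConj_phiInv, phiInv_phi h]
  have h2 : h.parityConj X * parityOp γ = parityOp γ * X := by
    rw [h.parityConj_apply, mul_assoc, h.star_parityOp_mul, mul_one]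
  have h3 : Phi γ T (phi γ X) = phi γ (rightEvenPart γ T (phiInv γ (phi γ X))) +
    phi γ (rightOddPart γ T (phiInv γ (aParity n (phi γ X)))) := rfl
  rw [h3, h1, phiInv_phi h, ← map_add, ← h2, smul_add]
  rfl

/-- An even X is fixed by θ and commutes with P, so the two terms carrying P cancel and the other
two coincide. -/
theorem Phi_phi_of_even (h : IsMajorana n γ) (T : (E →L[ℂ] E) →L[ℂ] (E →L[ℂ] E))
    {X : E →L[ℂ] E} (hX : h.parityConj X = X) : Phi γ T (phi γ X) = phi γ (T X) := by
  rw [h.Phi_phi, hX, (h.parityConj_eq_self_iff.1 hX).eq]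
  congr 1
  module

/-- Each of the four terms in `Phi_phi` is separately symmetric, for X of either parity. Those
containing θ or left multiplication by P need that T commutes with θ. -/
theorem isSelfAdjoint_Phi (h : IsMajorana n γ) {T : (E →L[ℂ] E) →L[ℂ] (E →L[ℂ] E)}
    (hT : ∀ X Y, tr (star (T X) * Y) = tr (star X * T Y))
    (hT' : ∀ X, T (h.parityConj X) = h.parityConj (T X)) : IsSelfAdjoint (Phi γ T) := by
  rw [ContinuousLinearMap.isSelfAdjoint_iff_isSymmetric]
  intro v w
  rw [← phi_phiInv h v, ← phi_phiInv h w]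
  generalize phiInv γ v = X
  generalize phiInv γ w = Y
  change inner ℂ (Phi γ T (phi γ X)) (phi γ Y) = inner ℂ (phi γ X) (Phi γ T (phi γ Y))
  rw [h.Phi_phi, h.Phi_phi, h.inner_phi_phi, h.inner_phi_phi]
  congr 1
  set P := parityOp γ with hP
  have hneg : ∀ Z : E →L[ℂ] E, tr (-Z) = -tr Z := fun Z => by simp [tr]
  have hhalf : star (1 / 2 : ℂ) = 1 / 2 := by simp
  have e2 : tr (star (T (X * P) * star P) * Y) = tr (star X * (T (Y * P) * star P)) := by
    rw [star_mul, star_star, mul_assoc, tr_mul_comm, mul_assoc, hT, star_mul, mul_assoc,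
      tr_mul_comm, mul_assoc]
  have e3 : tr (star (T (h.parityConj X)) * Y) = tr (star X * T (h.parityConj Y)) := by
    rw [← hT, hT', ← map_star, ← h.tr_parityConj, map_mul, h.parityConj_parityConj]
  have e4 : tr (star (T (P * X) * star P) * Y) = tr (star X * (T (P * Y) * star P)) := by
    have h1 : P * Y = h.parityConj (Y * P) := by
      rw [h.parityConj_apply, ← hP, mul_assoc, mul_assoc, h.parityOp_mul_star, mul_one]
    -- This rests on θ being an involution: P† Z = P† θ(θ Z) = θ(Z) P†.
    have h2 : h.parityConj (T (Y * P)) * star P = star P * T (Y * P) := by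
      have h3 := h.parityConj_parityConj (T (Y * P))
      conv_rhs => rw [← h3, h.parityConj_apply, ← hP, ← mul_assoc, ← mul_assoc,
        h.star_parityOp_mul, one_mul]
    rw [star_mul, star_star, mul_assoc, tr_mul_comm, mul_assoc, hT, star_mul, mul_assoc, h1, hT',
      h2]
  simp only [star_smul, star_add, star_neg, neg_mul, mul_neg, hhalf, smul_mul_assoc, mul_smul_comm,
    tr_smul, add_mul, mul_add, sub_eq_add_neg, tr_add, hneg, e2, e3, e4, hT X Y]

end IsMajorana

/-! ### Parity covariance of the adjoint Lindbladian, and P as a test vector. -/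

namespace SpectralResolution

variable {ι : Type*} [Fintype ι] [DecidableEq ι] {H : E →L[ℂ] E} {Q : ι → E →L[ℂ] E} {ε : ι → ℝ}
variable {n : ℕ} {γ : Fin (2 * n) → E →L[ℂ] E}

/-- `H` is even, so its spectral projections commute with P and every component inherits the oddness
of γ_j. -/
theorem parityConj_component (h : SpectralResolution H Q ε) (hγ : IsMajorana n γ)
    (hH : H ∈ evenOps γ) (j : Fin (2 * n)) (p : ι × ι) :
    hγ.parityConj (component Q (γ j) p) = -component Q (γ j) p := by
  have hQ : ∀ i, hγ.parityConj (Q i) = Q i := fun i => hγ.parityConj_eq_self_iff.2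
    (h.commute _ (hγ.parityConj_eq_self_iff.1 (hγ.mem_evenOps_iff.1 hH)) i)
  rw [component, map_mul, map_mul, hQ, hQ, hγ.parityConj_majorana, mul_neg, neg_mul]

theorem hsAdjoint_lindbladian_parityConj (h : SpectralResolution H Q ε) (hγ : IsMajorana n γ)
    (hH : H ∈ evenOps γ) {β : ℝ} (hβ : 0 < β) (X : E →L[ℂ] E) :
    hsAdjoint (lindbladian β H γ) (hγ.parityConj X) =
      hγ.parityConj (hsAdjoint (lindbladian β H γ) X) := by
  rw [h.hsAdjoint_lindbladian_apply hβ, h.hsAdjoint_lindbladian_apply hβ]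
  simp only [map_sum, map_add, map_smul, map_mul, map_star, h.parityConj_component hγ hH, star_neg,
    neg_mul, mul_neg, neg_neg]

/-- Components anticommute with P. The jump term passes one of them and changes sign; the drift
passes two and does not, so the cancellation seen at the identity becomes a doubling. -/
theorem hsAdjoint_lindbladian_parityOp (h : SpectralResolution H Q ε) (hγ : IsMajorana n γ)
    (hH : H ∈ evenOps γ) {β : ℝ} (hβ : 0 < β) :
    hsAdjoint (lindbladian β H γ) (parityOp γ) = ∑ j, ∑ p, ∑ q,
      ((-2 * kossakowski β (bohrFreq ε p) (bohrFreq ε q) : ℝ) : ℂ) •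
        (parityOp γ * (star (component Q (γ j) p) * component Q (γ j) q)) := by
  rw [h.hsAdjoint_lindbladian_apply hβ]
  refine Finset.sum_congr rfl fun j _ => Finset.sum_congr rfl fun p _ =>
    Finset.sum_congr rfl fun q _ => ?_
  have hC : ∀ Z, hγ.parityConj Z = -Z → Z * parityOp γ = -(parityOp γ * Z) := by
    intro Z hZ
    rw [eq_neg_iff_add_eq_zero, ← neg_eq_iff_add_eq_zero, ← neg_mul, ← hZ, hγ.parityConj_apply,
      mul_assoc, hγ.star_parityOp_mul, mul_one]
  have h1 := hC _ (h.parityConj_component hγ hH j q)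
  have h2 := hC (star (component Q (γ j) p)) (by
    rw [map_star, h.parityConj_component hγ hH, star_neg])
  rw [h2, mul_assoc _ _ (parityOp γ), h1, neg_mul, mul_neg, ← mul_assoc (star _) (parityOp γ), h2,
    neg_mul, neg_neg, mul_assoc (parityOp γ), add_assoc, ← add_smul, ← ofReal_add,
    driftCoeff_add_swap, kossakowski_comm β (bohrFreq ε q)]
  push_cast
  module

theorem tr_star_component_mul_component (h : SpectralResolution H Q ε) (A : E →L[ℂ] E)
    {p q : ι × ι} (hpq : p ≠ q) : tr (star (component Q A p) * component Q A q) = 0 := by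
  have h0 : tr (0 : E →L[ℂ] E) = 0 := by simp [tr]
  simp only [component, star_mul, h.star_eq]
  by_cases h1 : p.1 = q.1
  · have h2 : q.2 ≠ p.2 := fun e => hpq (Prod.ext h1 e.symm)
    rw [← mul_assoc _ (Q q.1 * A), tr_mul_comm]
    simp only [← mul_assoc]
    rw [h.mul_eq q.2 p.2, if_neg h2]
    simpa using h0
  · rw [mul_assoc (Q p.2), mul_assoc (star A), ← mul_assoc (Q p.1), ← mul_assoc (Q p.1), h.mul_eq,
      if_neg h1]
    simpa using h0

/-- P commutes with σ and drops out by unitarity. Components with different indices are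
trace-orthogonal, so with w = σ^{1/2} only the terms -2 α(ν, ν) ‖C w‖² survive. -/
theorem tr_symmetrized_parityOp_neg [Nontrivial E] (h : SpectralResolution H Q ε)
    (hγ : IsMajorana n γ) (hn : 0 < n) (hH : H ∈ evenOps γ) (hHs : IsSelfAdjoint H) {β : ℝ}
    (hβ : 0 < β) :
    (tr (star (gibbsConj β H (1 / 4) (parityOp γ)) *
      gibbsConj β H (1 / 4) (hsAdjoint (lindbladian β H γ) (parityOp γ)))).re < 0 := by
  set P := parityOp γ with hP
  set u := gibbsPow β H (1 / 4) with hu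
  set w := gibbsPow β H (1 / 2) with hw
  have huu : u * u = w := by rw [hu, hw, gibbsPow_mul hHs]; norm_num
  have hus : star u = u := (isSelfAdjoint_gibbsPow β H _).star_eq
  have hws : star w = w := (isSelfAdjoint_gibbsPow β H _).star_eq
  have hHP : Commute H P := hγ.parityConj_eq_self_iff.1 (hγ.mem_evenOps_iff.1 hH)
  have hPP : star P * P = 1 := hγ.star_parityOp_mul
  have hwP : w * P = P * w := (commute_gibbsPow hHs hHP β _).eq
  have hcomm : ∀ i, Commute w (Q i) := fun i =>
    commute_gibbsPow hHs (h.commute H (Commute.refl H) i).symm β _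
  have key : ∀ M, tr (star (u * P * u) * (u * (P * M) * u)) = tr (w * M * w) := by
    intro M
    calc tr (star (u * P * u) * (u * (P * M) * u))
        = tr (u * (star P * (u * u) * P * M * u)) := by
          simp only [star_mul, hus, mul_assoc]
      _ = tr (star P * (w * P) * M * (u * u)) := by
          rw [tr_mul_comm, huu]
          simp only [mul_assoc, huu]
      _ = tr (w * M * w) := by
          rw [hwP, ← mul_assoc (star P), hPP, one_mul, huu]
  have hcw : ∀ j p, component Q (γ j) p * w = component Q (γ j * w) p := by
    intro j p
    simp only [component, mul_assoc, (hcomm _).eq]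
  have hsum : tr (star (gibbsConj β H (1 / 4) P) *
      gibbsConj β H (1 / 4) (hsAdjoint (lindbladian β H γ) P)) = ∑ j, ∑ p : ι × ι,
      ((-2 * kossakowski β (bohrFreq ε p) (bohrFreq ε p) *
        (tr (star (component Q (γ j * w) p) * component Q (γ j * w) p)).re : ℝ) : ℂ) := by
    rw [h.hsAdjoint_lindbladian_parityOp hγ hH hβ, gibbsConj_apply, gibbsConj_apply]
    simp only [Finset.mul_sum, Finset.sum_mul, tr_sum, mul_smul_comm, smul_mul_assoc, tr_smul]
    refine Finset.sum_congr rfl fun j _ => Finset.sum_congr rfl fun p _ => ?_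
    rw [Finset.sum_eq_single p]
    · rw [key, ofReal_mul (_ * _), tr_star_mul_self_re, ← hcw, star_mul, hws]
      simp only [mul_assoc]
    · intro q _ hq
      have h1 := h.tr_star_component_mul_component (γ j * w) hq.symm
      rw [← hcw, ← hcw, star_mul, hws] at h1
      rw [key, mul_eq_zero]
      right
      simpa only [mul_assoc] using h1
    · simp
  rw [hsum]
  simp only [← ofReal_sum, ofReal_re]
  have hle : ∀ j p, -2 * kossakowski β (bohrFreq ε p) (bohrFreq ε p) *
      (tr (star (component Q (γ j * w) p) * component Q (γ j * w) p)).re ≤ 0 := fun j p => by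
    have h1 := kossakowski_pos β (bohrFreq ε p) (bohrFreq ε p)
    have h2 := tr_star_mul_self_nonneg (component Q (γ j * w) p)
    rw [neg_mul, neg_mul, neg_nonpos]
    positivity
  let j₀ : Fin (2 * n) := ⟨0, by omega⟩
  -- Strictness: γ_{j₀} w is invertible, so its components cannot all vanish.
  obtain ⟨p₀, hp₀⟩ : ∃ p, component Q (γ j₀ * w) p ≠ 0 := by
    by_contra! hcon
    have h1 := h.sum_component (γ j₀ * w)
    rw [Finset.sum_eq_zero fun p _ => hcon p] at h1
    have h2 : γ j₀ * (γ j₀ * w) * gibbsPow β H (-(1 / 2)) = 1 := by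
      rw [← mul_assoc, hγ.mul_self, one_mul, hw, gibbsPow_mul hHs, add_neg_cancel,
        gibbsPow_zero hHs]
    rw [← h1, mul_zero, zero_mul] at h2
    exact zero_ne_one h2
  refine Finset.sum_neg' (fun j _ => Finset.sum_nonpos fun p _ => hle j p)
    ⟨j₀, Finset.mem_univ _, Finset.sum_neg' (fun p _ => hle j₀ p) ⟨p₀, Finset.mem_univ _, ?_⟩⟩
  have h1 := kossakowski_pos β (bohrFreq ε p₀) (bohrFreq ε p₀)
  have h2 := tr_star_mul_self_pos hp₀
  rw [neg_mul, neg_mul, neg_neg_iff_pos]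
  positivity

end SpectralResolution

theorem IsMajorana.parityOp_mem_evenOps {E : Type*} [NormedAddCommGroup E] [InnerProductSpace ℂ E]
    [FiniteDimensional ℂ E] [CompleteSpace E] {n : ℕ} {γ : Fin (2 * n) → E →L[ℂ] E}
    (h : IsMajorana n γ) : parityOp γ ∈ evenOps γ :=
  h.mem_evenOps_iff.2 (h.parityConj_eq_self_iff.2 (Commute.refl _))

theorem gibbsConj_parityConj {E : Type*} [NormedAddCommGroup E] [InnerProductSpace ℂ E]
    [FiniteDimensional ℂ E] [CompleteSpace E] [Nontrivial E] {n : ℕ}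
    {γ : Fin (2 * n) → E →L[ℂ] E} (hγ : IsMajorana n γ) {H : E →L[ℂ] E} (hH : H ∈ evenOps γ)
    (hHs : IsSelfAdjoint H) (β s : ℝ) (X : E →L[ℂ] E) :
    gibbsConj β H s (hγ.parityConj X) = hγ.parityConj (gibbsConj β H s X) := by
  have h1 : hγ.parityConj (gibbsPow β H s) = gibbsPow β H s :=
    hγ.parityConj_eq_self_iff.2
      (commute_gibbsPow hHs (hγ.parityConj_eq_self_iff.1 (hγ.mem_evenOps_iff.1 hH)) β s)
  rw [gibbsConj_apply, gibbsConj_apply, map_mul, map_mul, h1]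

end ThirdQuantization

end

/-! ### Assembly of the theorem. -/

theorem mainTheorem9 {E : Type*} [NormedAddCommGroup E] [InnerProductSpace ℂ E]
    [FiniteDimensional ℂ E] [CompleteSpace E] (n : ℕ) (hn : 0 < n)
    (γ : Fin (2 * n) → E →L[ℂ] E) (hγ : ThirdQuantization.IsMajorana n γ)
    (H : E →L[ℂ] E) (hH : IsSelfAdjoint H) (hHeven : H ∈ ThirdQuantization.evenOps γ)
    (β : ℝ) (hβ : 0 < β) :
    IsSelfAdjoint (ThirdQuantization.parentHamiltonian β H γ) ∧
    ∃ hL : ∀ X ∈ ThirdQuantization.evenOps γ,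
        (ThirdQuantization.hsAdjoint (ThirdQuantization.lindbladian β H γ)).toLinearMap X ∈
          ThirdQuantization.evenOps γ,
      Module.End.HasEigenvalue (ThirdQuantization.parentHamiltonian β H γ).toLinearMap 0 ∧
      Module.End.HasEigenvalue
        ((ThirdQuantization.hsAdjoint
          (ThirdQuantization.lindbladian β H γ)).toLinearMap.restrict hL) 0 ∧
      (∃ Δ Δ' : ℝ,
        IsGreatest (ThirdQuantization.negEigenvalues
          (ThirdQuantization.parentHamiltonian β H γ).toLinearMap) (-Δ) ∧
        IsGreatest (ThirdQuantization.negEigenvalues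
          ((ThirdQuantization.hsAdjoint
            (ThirdQuantization.lindbladian β H γ)).toLinearMap.restrict hL)) (-Δ') ∧
        Δ ≤ Δ') ∧
      Module.finrank ℂ (Module.End.eigenspace
          ((ThirdQuantization.hsAdjoint
            (ThirdQuantization.lindbladian β H γ)).toLinearMap.restrict hL) 0) ≤
        Module.finrank ℂ (Module.End.eigenspace
          (ThirdQuantization.parentHamiltonian β H γ).toLinearMap 0) := by
  have : Nontrivial E := Module.nontrivial_of_finrank_pos (R := ℂ) (by
    rw [hγ.finrank_eq]; positivity)
  obtain ⟨s, Q, h⟩ := ThirdQuantization.exists_spectralResolution hH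
  set S := ThirdQuantization.hsAdjoint (ThirdQuantization.lindbladian β H γ)
  set Γ := ThirdQuantization.gibbsConj β H (1 / 4) with hΓ
  have hSθ : ∀ X, S (hγ.parityConj X) = hγ.parityConj (S X) :=
    h.hsAdjoint_lindbladian_parityConj hγ hHeven hβ
  have hΓθ : ∀ t X, ThirdQuantization.gibbsConj β H t (hγ.parityConj X) =
      hγ.parityConj (ThirdQuantization.gibbsConj β H t X) :=
    ThirdQuantization.gibbsConj_parityConj hγ hHeven hH β
  have hself : IsSelfAdjoint (ThirdQuantization.parentHamiltonian β H γ) := by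
    refine hγ.isSelfAdjoint_Phi (h.tr_star_symmetrized_mul hH hβ hγ.isSelfAdjoint) fun X => ?_
    change Γ (S (ThirdQuantization.gibbsConj β H (-(1 / 4)) (hγ.parityConj X))) = _
    rw [hΓθ, hSθ, hΓθ]
    rfl
  have hL : ∀ X ∈ ThirdQuantization.evenOps γ,
      S.toLinearMap X ∈ ThirdQuantization.evenOps γ := fun X hX => by
    rw [hγ.mem_evenOps_iff] at hX ⊢
    change hγ.parityConj (S X) = S X
    rw [← hSθ, hX]
  refine ⟨hself, hL, ?_⟩
  -- The intertwiner φ ∘ Γ, restricted to the even operators, where `Phi` acts without the sign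
  -- (-1)^n̂.
  let J : ThirdQuantization.evenOps γ →ₗ[ℂ] ThirdQuantization.Enlarged n :=
    (ThirdQuantization.phi γ ∘L Γ).toLinearMap ∘ₗ (ThirdQuantization.evenOps γ).subtype
  have hJ : Function.Injective J := by
    intro X Y hXY
    have h0 : Γ X = Γ Y := hγ.phi_injective hXY
    have h1 := congrArg (ThirdQuantization.gibbsConj β H (-(1 / 4))) h0
    simp only [hΓ, ThirdQuantization.gibbsConj_gibbsConj hH, neg_add_cancel,
      ThirdQuantization.gibbsConj_zero hH] at h1
    exact Subtype.ext h1
  have hint : ∀ X, (ThirdQuantization.parentHamiltonian β H γ).toLinearMap (J X) =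
      J (S.toLinearMap.restrict hL X) := by
    rintro ⟨X, hX⟩
    rw [hγ.mem_evenOps_iff] at hX
    change ThirdQuantization.Phi γ _ (ThirdQuantization.phi γ (Γ X)) =
      ThirdQuantization.phi γ (Γ (S X))
    rw [hγ.Phi_phi_of_even _ (by rw [hΓ, ← hΓθ, hX])]
    change ThirdQuantization.phi γ
      (Γ (S (ThirdQuantization.gibbsConj β H (-(1 / 4)) (Γ X)))) = _
    rw [hΓ, ThirdQuantization.gibbsConj_gibbsConj hH, neg_add_cancel,
      ThirdQuantization.gibbsConj_zero hH]
  have h0 : Module.End.HasEigenvalue (S.toLinearMap.restrict hL) 0 := by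
    refine Module.End.hasEigenvalue_of_hasEigenvector
      (x := ⟨1, ThirdQuantization.one_mem_evenOps γ⟩)
      ⟨Module.End.mem_eigenspace_iff.2 (Subtype.ext ?_), fun h1 => ?_⟩
    · rw [zero_smul]
      exact h.hsAdjoint_lindbladian_one hβ γ
    · exact one_ne_zero (congrArg Subtype.val h1)
  -- One even vector with negative quadratic form gives ℒ† a negative eigenvalue on the even
  -- operators; the parent Hamiltonian obtains it by inclusion of spectra.
  obtain ⟨r, hr, hev⟩ := ThirdQuantization.exists_neg_eigenvalue_of_intertwining
    (ContinuousLinearMap.isSelfAdjoint_iff_isSymmetric.1 hself) hJ hint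
    (x := ⟨ThirdQuantization.parityOp γ, hγ.parityOp_mem_evenOps⟩) (by
      change (inner ℂ (ThirdQuantization.phi γ _) (ThirdQuantization.phi γ _) : ℂ).re < 0
      rw [hγ.inner_phi_phi]
      have h1 := h.tr_symmetrized_parityOp_neg hγ hn hHeven hH hβ
      have h2 : ((2 ^ n : ℂ)⁻¹) = (((2 : ℝ) ^ n)⁻¹ : ℝ) := by push_cast; rfl
      rw [h2, Complex.re_ofReal_mul]
      exact mul_neg_of_pos_of_neg (by positivity) h1)
  have hsub : ThirdQuantization.negEigenvalues (S.toLinearMap.restrict hL) ⊆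
      ThirdQuantization.negEigenvalues
        (ThirdQuantization.parentHamiltonian β H γ).toLinearMap := fun x hx =>
    ⟨hx.1, ThirdQuantization.hasEigenvalue_of_intertwining hJ hint hx.2⟩
  obtain ⟨b, hb⟩ := ThirdQuantization.exists_isGreatest_negEigenvalues
    (f := S.toLinearMap.restrict hL) ⟨r, hr, hev⟩
  obtain ⟨a, ha⟩ := ThirdQuantization.exists_isGreatest_negEigenvalues ⟨b, hsub hb.1⟩
  exact ⟨ThirdQuantization.hasEigenvalue_of_intertwining hJ hint h0, h0,
    ⟨-a, -b, by rwa [neg_neg], by rwa [neg_neg], neg_le_neg (ha.2 (hsub hb.1))⟩,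
    ThirdQuantization.finrank_eigenspace_le_of_intertwining hJ hint 0⟩
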